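/- All graphs are finite and simple. The order of a graph is its number of vertices. A cummerbund of a graph is a longest cycle of it, and the cummerbund covering number ${\rm cc}(G)$ of a graph $G$ is the number of vertices of $G$ that lie in a cummerbund. For positive integers $l_1,\dots,l_k$, the theta graph $\theta(l_1,\dots,l_k)$ is obtained by connecting two vertices by pairwise internally disjoint paths of lengths $l_1,\dots,l_k$; an exponent, as in $\theta(a^s,b^t,\dots)$, means that the length is repeated that many times. (1) For every integer $n\ge 8$, the minimum of ${\rm cc}(G)$ over all $2$-connected graphs $G$ of order $n$ with girth at least $4$ is $6$. Moreover $\theta(3^2,2^{n-6})$ is a $2$-connected graph of order $n$ and girth $4$ with cummerbund covering number $6$. (2) For every integer $n\ge 10$, the minimum of ${\rm cc}(G)$ over all $2$-connected graphs $G$ of order $n$ with girth at least $5$ is $8$. Moreover the following $H$ is a $2$-connected graph of order $n$ and girth $5$ with ${\rm cc}(H)=8$: if $n$ is odd, $H=\theta(4^2,3^{(n-9)/2},2)$; if $n$ is even, $H$ is obtained from $T=\theta(4^2,3^{(n-10)/2},2)$, in which $xpqry$ is a path of length $4$ joining the two vertices $x,y$ of degree greater than $2$, by adding the edge $xr$ and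 then subdividing it once. (3) For every even integer $n\ge 12$, the minimum of ${\rm cc}(G)$ over all $2$-connected graphs $G$ of order $n$ with girth at least $6$ is $8$. Moreover $\theta(4^2,3^{(n-8)/2})$ is a $2$-connected graph of order $n$ and girth $6$ with cummerbund covering number $8$. (4) For every odd integer $n\ge 13$, the minimum of ${\rm cc}(G)$ over all $2$-connected graphs $G$ of order $n$ with girth at least $6$ is $9$. Moreover $\theta(5,4,3^{(n-9)/2})$ is a $2$-connected graph of order $n$ and girth $6$ with cummerbund covering number $9$. -/

import Mathlib

namespace Cummerbund

/-- A graph is `k`-connected if it has more than `k` vertices and stays connected after the removal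
of any set of fewer than `k` vertices. -/
def IsVertexConnected {V : Type*} (G : SimpleGraph V) (k : ℕ) : Prop :=
  k < Nat.card V ∧ ∀ S : Finset V, S.card < k → (G.induce ((S : Set V)ᶜ)).Connected

/-- A cummerbund is a longest cycle. -/
def IsCummerbund {V : Type*} {G : SimpleGraph V} {a : V} (w : G.Walk a a) : Prop :=
  w.IsCycle ∧ ∀ (b : V) (w' : G.Walk b b), w'.IsCycle → w'.length ≤ w.length

/-- The cummerbund covering number: the number of vertices that lie in a cummerbund. -/
noncomputable def cc {V : Type*} (G : SimpleGraph V) : ℕ :=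
  Set.ncard {v : V | ∃ (a : V) (w : G.Walk a a), IsCummerbund w ∧ v ∈ w.support}

/-- The cummerbund covering numbers of the 2-connected graphs of order `n` with girth at least `g`
(graphs are taken up to isomorphism, so the vertex set may be taken to be `Fin n`). -/
def ccValues (n g : ℕ) : Set ℕ :=
  {c | ∃ G : SimpleGraph (Fin n), IsVertexConnected G 2 ∧ (g : ℕ∞) ≤ G.egirth ∧ cc G = c}

/-- `G` is a 2-connected graph of order `n` and girth exactly `g` whose cummerbund covering number
is `c`. -/
structure IsExample {V : Type*} (G : SimpleGraph V) (n g c : ℕ) : Prop where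
  order : Nat.card V = n
  connected : IsVertexConnected G 2
  girth : G.egirth = (g : ℕ∞)
  covering : cc G = c

/-- Vertices of the theta graph with path lengths `l`: the two end vertices (`false` and `true`) and
`l i - 1` internal vertices on the `i`-th path. -/
abbrev ThetaVertex (l : List ℕ) : Type := Bool ⊕ (Σ i : Fin l.length, Fin (l.get i - 1))

/-- The `j`-th vertex of the `i`-th path of the theta graph, for `0 ≤ j ≤ l i`: the end vertex
`false` for `j = 0`, the end vertex `true` for `j = l i`, an internal vertex otherwise. -/
def thetaPoint (l : List ℕ) (i : Fin l.length) (j : ℕ) : ThetaVertex l :=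
  if j = 0 then Sum.inl false
  else if h : j - 1 < l.get i - 1 then Sum.inr ⟨i, ⟨j - 1, h⟩⟩
  else Sum.inl true

/-- The theta graph `θ(l₁, …, l_k)`: two vertices joined by pairwise internally disjoint paths of
lengths `l₁, …, l_k`. -/
def thetaGraph (l : List ℕ) : SimpleGraph (ThetaVertex l) :=
  SimpleGraph.fromRel fun u v =>
    ∃ (i : Fin l.length) (j : ℕ), j < l.get i ∧ u = thetaPoint l i j ∧ v = thetaPoint l i (j + 1)

/-- The graph obtained from `G` by adding one new vertex (`none`), adjacent exactly to `x` and `r`;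
for distinct nonadjacent `x`, `r` this is adding the edge `xr` and then subdividing it. -/
def addSubdividedEdge {V : Type*} (G : SimpleGraph V) (x r : V) : SimpleGraph (Option V) :=
  SimpleGraph.fromRel fun u v =>
    (∃ a b : V, G.Adj a b ∧ u = some a ∧ v = some b) ∨ (u = none ∧ (v = some x ∨ v = some r))

/-- The path lengths `4², 3^m, 2`. -/
abbrev lengths432 (m : ℕ) : List ℕ := 4 :: 4 :: (List.replicate m 3 ++ [2])

/-- In `T = θ(4², 3^m, 2)` let `x p q r y` be the first path of length `4` between the two end
vertices `x`, `y`; add the edge `xr` to `T` and subdivide it. -/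
def modifiedTheta (m : ℕ) : SimpleGraph (Option (ThetaVertex (lengths432 m))) :=
  addSubdividedEdge (thetaGraph (lengths432 m))
    (thetaPoint (lengths432 m) ⟨0, Nat.succ_pos _⟩ 0)
    (thetaPoint (lengths432 m) ⟨0, Nat.succ_pos _⟩ 3)

end Cummerbund

namespace Cummerbund

/-! The lower bounds rest on ears. Fix a longest cycle C of length c. By 2-connectedness every
vertex off C lies on an ear, a path with inner vertices off C that joins two distinct vertices of C
(`IsVertexConnected.exists_isEar`). Let the ear have m inner vertices and let its ends cut C into
arcs with p and q inner vertices, so c = p + q + 2. Exchanging an arc for the ear gives cycles of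
lengths m + p + 2 and m + q + 2. Both are at least the girth, and maximality gives m ≤ p and m ≤ q.
If m = p or m = q, the ear lies on another longest cycle and is covered (`IsLongest.ear_bounds`).

Girth 4 (`six_le_cc`): if c ≤ 5, equality holds for every ear, so all vertices are covered. Girth 5
(`eight_le_cc`): if fewer than 8 vertices are covered, every ear has one inner vertex and c is 6 or
7. The vertices off C then join vertices of C at distance 3, and two of them (c = 6) or three (c =
7) create a 4-cycle or a cycle longer than C. Girth 6, odd order (`nine_le_cc`): if at most 8
vertices are covered, then c = 8 and exactly C is covered. All ears join the same antipodal pair of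
C, and the girth leaves only ears with two inner vertices. These match the vertices off C in pairs,
so the order is even.

For sharpness, every cycle of a theta graph is the union of two of its paths
(`thetaGraph_exists_pair`), so girth and longest cycles are read off the path lengths. In the
modified theta graph the cycles through the new vertex have length at most 7, so the longest cycle
is still the union of the two paths of length 4. -/

variable {V : Type*} {G : SimpleGraph V}

/-! ### Cycles as lists of vertices -/

/-- The vertices of a cycle, listed in cyclic order. -/
structure IsCycleList (G : SimpleGraph V) (l : List V) : Prop where
  three_le : 3 ≤ l.length
  nodup : l.Nodup
  chain : Cycle.Chain G.Adj (l : Cycle V)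

theorem IsCycleList.of_isRotated {l l' : List V} (h : IsCycleList G l) (r : l ~r l') :
    IsCycleList G l' where
  three_le := r.perm.length_eq ▸ h.three_le
  nodup := r.nodup_iff.1 h.nodup
  chain := (Cycle.coe_eq_coe.2 r) ▸ h.chain

theorem isCycleList_cons {a : V} {l : List V} :
    IsCycleList G (a :: l) ↔
      2 ≤ l.length ∧ (a :: l).Nodup ∧ List.IsChain G.Adj (a :: (l ++ [a])) := by
  constructor
  · rintro ⟨h1, h2, h3⟩
    exact ⟨by simpa using h1, h2, by simpa using h3⟩
  · rintro ⟨h1, h2, h3⟩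
    exact ⟨by simpa using h1, h2, by simpa using h3⟩

theorem IsCycleList.exists_walk {l : List V} (h : IsCycleList G l) :
    ∃ (a : V) (w : G.Walk a a), w.IsCycle ∧ w.length = l.length ∧ ∀ v, v ∈ w.support ↔ v ∈ l := by
  obtain _ | ⟨a, l⟩ := l
  · simpa using h.three_le
  obtain ⟨h1, h2, h3⟩ := isCycleList_cons.1 h
  obtain ⟨w, hw⟩ : ∃ w : G.Walk a a, w.support = a :: (l ++ [a]) := by
    refine ⟨(SimpleGraph.Walk.ofSupport _ (by simp) h3).copy (by simp) (by simp), ?_⟩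
    exact (SimpleGraph.Walk.support_copy _ _ _).trans (SimpleGraph.Walk.support_ofSupport _ _)
  have hl : w.length = (a :: l).length := by
    have := w.length_support
    rw [hw] at this
    simpa using this.symm
  refine ⟨a, w, ?_, hl, fun v => by rw [hw]; simp; tauto⟩
  rw [SimpleGraph.Walk.isCycle_iff_isPath_tail_and_le_length, hl]
  refine ⟨?_, by simpa using h1⟩
  rw [SimpleGraph.Walk.isPath_def, SimpleGraph.Walk.support_tail_of_not_nil, hw]
  · simpa using (List.perm_append_singleton a l).nodup_iff.2 h2
  · rw [SimpleGraph.Walk.not_nil_iff_lt_length, hl]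
    simp

theorem exists_isCycleList_of_isCycle {a : V} {w : G.Walk a a} (h : w.IsCycle) :
    ∃ l, IsCycleList G l ∧ l.length = w.length ∧ ∀ v, v ∈ w.support ↔ v ∈ l := by
  have h3 := h.three_le_length
  have hd := h.nodup_dropLast_support
  cases w with
  | nil => simp at h3
  | @cons _ b _ hab p =>
    have hs : (SimpleGraph.Walk.cons hab p).support = a :: (p.support.dropLast ++ [a]) := by
      rw [SimpleGraph.Walk.support_cons]
      congr 1
      have := List.dropLast_append_getLast p.support_ne_nil
      rw [p.getLast_support] at this
      exact this.symm
    have hl : (a :: p.support.dropLast).length = (SimpleGraph.Walk.cons hab p).length := by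
      simp
    refine ⟨a :: p.support.dropLast, isCycleList_cons.2 ⟨?_, ?_, ?_⟩, hl, ?_⟩
    · simp at h3 ⊢; omega
    · rw [hs] at hd
      rwa [← List.cons_append, List.dropLast_concat] at hd
    · rw [← hs]
      exact SimpleGraph.Walk.isChain_adj_support _
    · intro v
      rw [hs]
      simp only [List.mem_cons, List.mem_append, List.not_mem_nil]
      tauto

theorem natCast_le_egirth {n : ℕ} :
    (n : ℕ∞) ≤ G.egirth ↔ ∀ l, IsCycleList G l → n ≤ l.length := by
  rw [SimpleGraph.le_egirth]
  constructor
  · intro h l hl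
    obtain ⟨a, w, hw, hwl, -⟩ := hl.exists_walk
    have := h a w hw
    rw [← hwl]
    exact_mod_cast this
  · intro h a w hw
    obtain ⟨l, hl, hwl, -⟩ := exists_isCycleList_of_isCycle hw
    rw [← hwl]
    exact_mod_cast h l hl

/-- A longest cycle, as a list of vertices. -/
def IsLongest (G : SimpleGraph V) (l : List V) : Prop :=
  IsCycleList G l ∧ ∀ l', IsCycleList G l' → l'.length ≤ l.length

/-- The vertices that lie on a longest cycle. -/
def covered (G : SimpleGraph V) : Set V :=
  {v | ∃ l, IsLongest G l ∧ v ∈ l}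

theorem cc_eq_ncard_covered : cc G = (covered G).ncard := by
  unfold cc covered
  congr 1
  ext v
  constructor
  · rintro ⟨a, w, ⟨hw, hmax⟩, hv⟩
    obtain ⟨l, hl, hwl, hs⟩ := exists_isCycleList_of_isCycle hw
    refine ⟨l, ⟨hl, fun l' hl' => ?_⟩, (hs v).1 hv⟩
    obtain ⟨b, w', hw', hl2, -⟩ := hl'.exists_walk
    rw [hwl, ← hl2]
    exact hmax b w' hw'
  · rintro ⟨l, ⟨hl, hmax⟩, hv⟩
    obtain ⟨a, w, hw, hwl, hs⟩ := hl.exists_walk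
    refine ⟨a, w, ⟨hw, fun b w' hw' => ?_⟩, (hs v).2 hv⟩
    obtain ⟨l', hl', hl2, -⟩ := exists_isCycleList_of_isCycle hw'
    rw [hwl, ← hl2]
    exact hmax l' hl'

theorem IsCycleList.map {W : Type*} {H : SimpleGraph W} {l : List V} (h : IsCycleList G l)
    (f : V → W) (hf : Function.Injective f) (hadj : ∀ a b, G.Adj a b → H.Adj (f a) (f b)) :
    IsCycleList H (l.map f) where
  three_le := by simpa using h.three_le
  nodup := h.nodup.map hf
  chain := by
    have := (Cycle.chain_map (r := H.Adj) f (s := (l : Cycle V))).2 (h.chain.imp hadj)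
    simpa using this

/-! ### Paths in 2-connected graphs -/

/-- A walk in a graph from outside a set to the set contains a path ending at its first vertex in
the set. -/
theorem exists_isChain_to_set {T : Set V} :
    ∀ (l : List V) (u : V), List.IsChain G.Adj (u :: l) → (u :: l).Nodup → u ∉ T →
      (∃ t ∈ l, t ∈ T) → ∃ R x, List.IsChain G.Adj (u :: (R ++ [x])) ∧ (u :: R).Nodup ∧
        (∀ y ∈ R, y ∉ T ∧ y ∈ l) ∧ x ∈ T ∧ x ∈ l
  | [], u, _, _, _, ⟨t, ht, _⟩ => by simp at ht
  | v :: l, u, hc, hn, hu, ⟨t, ht, htT⟩ => by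
    rw [List.isChain_cons_cons] at hc
    by_cases hv : v ∈ T
    · exact ⟨[], v, by simpa using hc.1, by simp, by simp, hv, by simp⟩
    · obtain ⟨R, x, h1, h2, h3, h4, h5⟩ := exists_isChain_to_set l v hc.2 (List.nodup_cons.1 hn).2 hv
        ⟨t, by
          rcases List.mem_cons.1 ht with rfl | h
          · exact absurd htT hv
          · exact h, htT⟩
      refine ⟨v :: R, x, ?_, ?_, ?_, h4, by simp [h5]⟩
      · rw [List.cons_append, List.isChain_cons_cons]
        exact ⟨hc.1, h1⟩
      · rw [List.nodup_cons] at hn ⊢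
        refine ⟨fun h => hn.1 ?_, h2⟩
        rcases List.mem_cons.1 h with rfl | h
        · simp
        · simp [(h3 _ h).2]
      · intro y hy
        rcases List.mem_cons.1 hy with rfl | h
        · exact ⟨hv, by simp⟩
        · exact ⟨(h3 _ h).1, by simp [(h3 _ h).2]⟩

/-- Deleting `s` leaves a connected graph; a path in it from `u` to `T` is cut at its first vertex
in `T`. This is the form in which 2-connectedness enters the lower bounds. -/
theorem IsVertexConnected.exists_path {s : V} (hG : IsVertexConnected G 2)
    {u : V} {T : Set V} (hus : u ≠ s) (huT : u ∉ T) (hsT : s ∉ T) (hT : T.Nonempty) :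
    ∃ R x, List.IsChain G.Adj (u :: (R ++ [x])) ∧ (u :: R).Nodup ∧ (∀ y ∈ R, y ∉ T) ∧
      s ∉ R ∧ x ∈ T := by
  classical
  obtain ⟨t, ht⟩ := hT
  have hts : t ≠ s := fun h => hsT (h ▸ ht)
  have hconn := hG.2 {s} (by simp)
  obtain ⟨p, hp⟩ := hconn.preconnected.exists_isPath ⟨u, by simpa using hus⟩ ⟨t, by simpa using hts⟩
  let f : G.induce ((({s} : Finset V) : Set V)ᶜ) →g G := ⟨Subtype.val, fun h => h⟩
  have hp' : (p.map f).IsPath := SimpleGraph.Walk.IsPath.map Subtype.val_injective hp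
  have hs : s ∉ (p.map f).support := by
    rw [SimpleGraph.Walk.support_map]
    intro h
    obtain ⟨y, _, hy⟩ := List.mem_map.1 h
    exact y.2 (by simpa using (show (y : V) = s from hy))
  obtain ⟨l, hl⟩ : ∃ l, (p.map f).support = u :: l := ⟨_, (SimpleGraph.Walk.cons_tail_support _).symm⟩
  have hc := (p.map f).isChain_adj_support
  have htl := (p.map f).end_mem_support
  have hn := hp'.support_nodup
  rw [hl] at hc htl hn hs
  have hut : t ≠ u := fun h => huT (h ▸ ht)
  obtain ⟨R, x, h1, h2, h3, h4, h5⟩ := exists_isChain_to_set l u hc hn huT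
    ⟨t, (List.mem_cons.1 htl).resolve_left hut, ht⟩
  exact ⟨R, x, h1, h2, fun y hy => (h3 y hy).1, fun h => hs (by simp [(h3 s h).2]), h4⟩

/-- The walk from `a` to `b` through the list `m` of inner vertices. -/
def Link (G : SimpleGraph V) (a : V) (m : List V) (b : V) : Prop :=
  List.IsChain G.Adj (a :: (m ++ [b]))

@[simp]
theorem link_nil {a b : V} : Link G a [] b ↔ G.Adj a b := by
  simp [Link]

@[simp]
theorem link_cons {a b x : V} {m : List V} :
    Link G a (x :: m) b ↔ G.Adj a x ∧ Link G x m b := by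
  simp [Link]

@[simp]
theorem link_append {a b x : V} {p q : List V} :
    Link G a (p ++ x :: q) b ↔ Link G a p x ∧ Link G x q b := by
  induction p generalizing a with
  | nil => simp
  | cons y p ih => simp [ih, and_assoc]

theorem Link.symm {a b : V} {m : List V} (h : Link G a m b) : Link G b m.reverse a := by
  induction m generalizing a with
  | nil => simpa using (link_nil.1 h).symm
  | cons x m ih =>
    rw [link_cons] at h
    simp [ih h.2, h.1.symm]

theorem link_reverse {a b : V} {m : List V} : Link G a m.reverse b ↔ Link G b m a :=
  ⟨fun h => by simpa using h.symm, Link.symm⟩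

theorem isCycleList_cons_append {a b : V} {p q : List V} :
    IsCycleList G (a :: (p ++ b :: q)) ↔
      1 ≤ p.length + q.length ∧ (a :: (p ++ b :: q)).Nodup ∧ Link G a p b ∧ Link G b q a := by
  rw [isCycleList_cons, ← link_append, Link]
  simp only [List.length_append, List.length_cons]
  constructor
  · rintro ⟨h1, h2, h3⟩
    exact ⟨by omega, h2, h3⟩
  · rintro ⟨h1, h2, h3⟩
    exact ⟨by omega, h2, h3⟩

/-! ### Ears -/

/-- A path with inner vertices `m` outside of `l` that joins two distinct vertices of `l`. -/
structure IsEar (G : SimpleGraph V) (l : List V) (a : V) (m : List V) (b : V) : Prop where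
  left_mem : a ∈ l
  right_mem : b ∈ l
  ne : a ≠ b
  nodup : m.Nodup
  not_mem : ∀ x ∈ m, x ∉ l
  link : Link G a m b

theorem IsEar.symm {l m : List V} {a b : V} (h : IsEar G l a m b) : IsEar G l b m.reverse a where
  left_mem := h.right_mem
  right_mem := h.left_mem
  ne := h.ne.symm
  nodup := List.nodup_reverse.2 h.nodup
  not_mem := fun x hx => h.not_mem x (List.mem_reverse.1 hx)
  link := h.link.symm

/-- The second half of the ear, from `s` to `b`, is kept and entered from `u`. The path `R` leads
back from `u` to `x`, which is either on the first half, followed back to `a`, or a new end on `l`.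
The case of `x` on the other half follows by reversing the ear. -/
theorem IsEar.reroute {l m₁ m₂ R : List V} {a b s u x : V} (h : IsEar G l a (m₁ ++ s :: m₂) b)
    (hu : u ∉ l) (hum : u ∉ m₁ ++ s :: m₂) (hus : G.Adj u s) (hR : Link G u R x)
    (hn : (u :: R).Nodup) (hRl : ∀ y ∈ R, y ∉ l ∧ y ∉ m₁ ++ s :: m₂)
    (hx : x ∈ m₁ ∨ x ∈ l ∧ x ≠ b) : ∃ a' m' b', IsEar G l a' m' b' ∧ u ∈ m' := by
  have hlink := link_append.1 h.link
  have hnd := h.nodup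
  have hnm := h.not_mem
  rcases hx with hx | ⟨hx, hxb⟩
  · obtain ⟨p, q, rfl⟩ := List.append_of_mem hx
    refine ⟨a, p ++ x :: (R.reverse ++ u :: s :: m₂), b,
      ⟨h.left_mem, h.right_mem, h.ne, ?_, ?_, ?_⟩, by simp⟩
    · clear hR hus hlink hnm
      simp only [List.nodup_append, List.nodup_cons, List.mem_append, List.mem_cons,
        List.nodup_reverse, List.mem_reverse] at *
      grind
    · intro y hy
      simp only [List.mem_append, List.mem_cons, List.mem_reverse] at *
      grind
    · simp only [link_append, link_cons, link_reverse] at *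
      exact ⟨hlink.1.1, hR, hus, hlink.2⟩
  · refine ⟨x, R.reverse ++ u :: s :: m₂, b, ⟨hx, h.right_mem, hxb, ?_, ?_, ?_⟩, by simp⟩
    · clear hR hus hlink hnm
      simp only [List.nodup_append, List.nodup_cons, List.mem_append, List.mem_cons,
        List.nodup_reverse, List.mem_reverse] at *
      grind
    · intro y hy
      simp only [List.mem_append, List.mem_cons, List.mem_reverse] at *
      grind
    · simp only [link_append, link_cons, link_reverse] at *
      exact ⟨hR, hus, hlink.2⟩

/-- In a 2-connected graph every vertex outside of a set with at least two vertices lies on a path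
that meets the set exactly in its two distinct ends. -/
theorem IsVertexConnected.exists_isEar (hG : IsVertexConnected G 2) {l : List V} {a₀ b₀ : V}
    (ha₀ : a₀ ∈ l) (hb₀ : b₀ ∈ l) (hne : a₀ ≠ b₀) {u : V} (hu : u ∉ l) :
    ∃ a m b, IsEar G l a m b ∧ u ∈ m := by
  -- The vertices that are on `l` or on some ear form a set `S`. If `S` misses a vertex, some edge
  -- leaves it, and the outer end `v` of that edge turns out to lie on an ear as well.
  by_contra hcon
  set S : Set V := {v | v ∈ l ∨ ∃ a m b, IsEar G l a m b ∧ v ∈ m} with hS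
  have huS : u ∉ S := fun h => h.elim hu hcon
  obtain ⟨v, s, hvS, hsS, hvs⟩ : ∃ v s, v ∉ S ∧ s ∈ S ∧ G.Adj v s := by
    obtain ⟨R, x, h1, -, h3, h4, h5⟩ := hG.exists_path (s := a₀) (u := u) (T := S \ {a₀})
      (fun h => hu (h ▸ ha₀)) (fun h => huS h.1) (fun h => h.2 rfl)
      ⟨b₀, Or.inl hb₀, fun h => hne h.symm⟩
    rcases List.eq_nil_or_concat R with rfl | ⟨R', y, rfl⟩
    · exact ⟨u, x, huS, h5.1, by simpa using h1⟩
    · refine ⟨y, x, fun hy => h3 y (by simp) ⟨hy, fun h => h4 ?_⟩, h5.1, ?_⟩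
      · rw [Set.mem_singleton_iff] at h
        simp [h]
      · rw [List.concat_eq_append] at h1
        change Link G u (R' ++ [y]) x at h1
        exact link_nil.1 (link_append.1 h1).2
  refine hvS (Or.inr ?_)
  have hvl : v ∉ l := fun h => hvS (Or.inl h)
  -- If `s` is on `l`, the edge `s v` and a path from `v` back to `l` avoiding `s` form an ear. If
  -- `s` is inside an ear, that ear is rerouted through `v`.
  rcases hsS with hsl | ⟨a, m, b, hear, hsm⟩
  · obtain ⟨R, x, h1, h2, h3, h4, h5⟩ := hG.exists_path (s := s) (u := v) (T := {y | y ∈ l} \ {s})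
      (fun h => hvl (h ▸ hsl)) (fun h => hvl h.1) (fun h => h.2 rfl) (by
        by_cases h : a₀ = s
        · exact ⟨b₀, hb₀, fun h' => hne (h.trans h'.symm)⟩
        · exact ⟨a₀, ha₀, h⟩)
    refine ⟨s, v :: R, x, ⟨hsl, h5.1, fun h => h5.2 h.symm, h2, ?_, ?_⟩, by simp⟩
    · intro y hy
      rcases List.mem_cons.1 hy with rfl | hy
      · exact hvl
      · exact fun hyl => h3 y hy ⟨hyl, fun h => h4 (h ▸ hy)⟩
    · exact link_cons.2 ⟨hvs.symm, h1⟩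
  · have hvm : v ∉ m := fun h => hvS (Or.inr ⟨a, m, b, hear, h⟩)
    obtain ⟨m₁, m₂, rfl⟩ := List.append_of_mem hsm
    obtain ⟨R, x, h1, h2, h3, h4, h5⟩ := hG.exists_path (s := s) (u := v)
      (T := {y | y ∈ l ∨ y ∈ m₁ ++ s :: m₂} \ {s}) hvs.ne
      (fun h => h.1.elim hvl hvm) (fun h => h.2 rfl)
      ⟨a, Or.inl hear.left_mem, fun h => hear.not_mem s hsm (h ▸ hear.left_mem)⟩
    have hR : ∀ y ∈ R, y ∉ l ∧ y ∉ m₁ ++ s :: m₂ := by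
      intro y hy
      have := h3 y hy
      have hys : y ≠ s := fun h => h4 (h ▸ hy)
      exact ⟨fun h => this ⟨Or.inl h, hys⟩, fun h => this ⟨Or.inr h, hys⟩⟩
    have hear' := hear.symm
    rw [List.reverse_append, List.reverse_cons, List.append_assoc, List.singleton_append] at hear'
    -- Since `a ≠ b`, a vertex `x` of `l` differs from at least one end, so the ear or its reverse
    -- can be rerouted.
    have hx : (x ∈ m₁ ∨ x ∈ l ∧ x ≠ b) ∨ (x ∈ m₂.reverse ∨ x ∈ l ∧ x ≠ a) := by
      have hxs := h5.2
      have hxm := h5.1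
      have hab := hear.ne
      simp only [Set.mem_ofPred_eq, List.mem_append, List.mem_cons, Set.mem_singleton_iff,
        List.mem_reverse] at hxm hxs ⊢
      grind
    rcases hx with hx | hx
    · exact hear.reroute hvl hvm hvs h1 h2 hR hx
    · have hmem : ∀ y, y ∈ m₂.reverse ++ s :: m₁.reverse ↔ y ∈ m₁ ++ s :: m₂ := by
        intro y
        simp only [List.mem_append, List.mem_cons, List.mem_reverse]
        tauto
      exact hear'.reroute hvl (fun h => hvm ((hmem v).1 h)) hvs h1 h2
        (fun y hy => ⟨(hR y hy).1, fun h => (hR y hy).2 ((hmem y).1 h)⟩) hx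

/-- A cycle through two given vertices consists of two paths between them. -/
theorem IsCycleList.exists_isRotated {l : List V} (h : IsCycleList G l) {a b : V} (ha : a ∈ l)
    (hb : b ∈ l) (hab : a ≠ b) :
    ∃ p q, l ~r a :: (p ++ b :: q) := by
  obtain ⟨s, t, rfl⟩ := List.append_of_mem ha
  have hr : s ++ a :: t ~r a :: (t ++ s) := by
    simpa using List.isRotated_append (l := s) (l' := a :: t)
  have hb' : b ∈ t ++ s := by
    have := hr.mem_iff.1 hb
    exact (List.mem_cons.1 this).resolve_left hab.symm
  obtain ⟨p, q, hpq⟩ := List.append_of_mem hb'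
  exact ⟨p, q, hpq ▸ hr⟩

/-- An ear of a cycle gives two further cycles. -/
theorem IsCycleList.ear {a b : V} {p q m : List V} (h : IsCycleList G (a :: (p ++ b :: q)))
    (hm : IsEar G (a :: (p ++ b :: q)) a m b) (hne : m ≠ []) :
    IsCycleList G (a :: (m ++ b :: q)) ∧ IsCycleList G (b :: (m.reverse ++ a :: p)) := by
  obtain ⟨h1, h2, h3, h4⟩ := isCycleList_cons_append.1 h
  have hpos : 0 < m.length := List.length_pos_of_ne_nil hne
  have hnd := hm.nodup
  have hnm := hm.not_mem
  constructor
  · refine isCycleList_cons_append.2 ⟨by omega, ?_, hm.link, h4⟩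
    simp only [List.nodup_append, List.nodup_cons, List.mem_append, List.mem_cons] at *
    grind
  · refine isCycleList_cons_append.2 ⟨by simp; omega, ?_, hm.link.symm, h3⟩
    simp only [List.nodup_append, List.nodup_cons, List.mem_append, List.mem_cons,
      List.nodup_reverse, List.mem_reverse] at *
    grind

theorem IsCycleList.isEar_congr {l l' m : List V} {a b : V} (h : IsEar G l a m b) (r : l ~r l') :
    IsEar G l' a m b where
  left_mem := r.mem_iff.1 h.left_mem
  right_mem := r.mem_iff.1 h.right_mem
  ne := h.ne
  nodup := h.nodup
  not_mem := fun x hx hl => h.not_mem x hx (r.mem_iff.2 hl)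
  link := h.link

theorem IsLongest.of_isRotated {l l' : List V} (h : IsLongest G l) (r : l ~r l') :
    IsLongest G l' :=
  ⟨h.1.of_isRotated r, fun l'' hl => r.perm.length_eq ▸ h.2 l'' hl⟩

theorem IsLongest.of_length_eq {l l' : List V} (h : IsLongest G l) (h' : IsCycleList G l')
    (hl : l'.length = l.length) : IsLongest G l' :=
  ⟨h', fun l'' hl' => hl ▸ h.2 l'' hl'⟩

/-- How an ear sits on a longest cycle, in a graph of girth at least `g`. -/
theorem IsLongest.ear_bounds {l m : List V} {a b : V} {g : ℕ} (h : IsLongest G l)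
    (hg : (g : ℕ∞) ≤ G.egirth) (hm : IsEar G l a m b) (hne : m ≠ []) :
    ∃ p q, l ~r a :: (p ++ b :: q) ∧ l.length = p.length + q.length + 2 ∧
      m.length ≤ p.length ∧ m.length ≤ q.length ∧ g ≤ m.length + p.length + 2 ∧
      g ≤ m.length + q.length + 2 ∧
      (m.length = p.length ∨ m.length = q.length → ∀ u ∈ m, u ∈ covered G) := by
  obtain ⟨p, q, r⟩ := h.1.exists_isRotated hm.left_mem hm.right_mem hm.ne
  have h' := h.of_isRotated r
  -- The first cycle replaces the arc `p` by the ear, the second the arc `q`.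
  obtain ⟨h1, h2⟩ := h'.1.ear (IsCycleList.isEar_congr hm r) hne
  have e1 := h'.2 _ h1
  have e2 := h'.2 _ h2
  have e3 := natCast_le_egirth.1 hg _ h1
  have e4 := natCast_le_egirth.1 hg _ h2
  have e5 := r.perm.length_eq
  simp only [List.length_cons, List.length_append, List.length_reverse] at e1 e2 e3 e4 e5
  refine ⟨p, q, r, by omega, by omega, by omega, by omega, by omega, ?_⟩
  rintro (hl | hl) u hu
  · exact ⟨_, h'.of_length_eq h1 (by simp; omega), by simp [hu]⟩
  · exact ⟨_, h'.of_length_eq h2 (by simp; omega), by simp [hu]⟩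

/-! ### Existence of longest cycles and counting of covered vertices -/

theorem isCycleList_cons_link {a : V} {l : List V} :
    IsCycleList G (a :: l) ↔ 2 ≤ l.length ∧ (a :: l).Nodup ∧ Link G a l a :=
  isCycleList_cons

theorem IsVertexConnected.finite {k : ℕ} (hG : IsVertexConnected G k) : Finite V :=
  Nat.finite_of_card_ne_zero (by have := hG.1; omega)

/-- A third vertex exists, and a path from `v` to it that avoids `s` starts with the required edge.
-/
theorem IsVertexConnected.exists_adj_ne (hG : IsVertexConnected G 2) {v s : V} (h : v ≠ s) :
    ∃ w, w ≠ s ∧ G.Adj v w := by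
  have := hG.finite
  obtain ⟨t, ht⟩ : ∃ t, t ∉ ({v, s} : Set V) := by
    by_contra! hcon
    have h1 : ({v, s} : Set V) = Set.univ := Set.eq_univ_of_forall hcon
    have h2 := Set.ncard_pair h
    rw [h1, Set.ncard_univ] at h2
    have := hG.1
    omega
  simp only [Set.mem_insert_iff, Set.mem_singleton_iff, not_or] at ht
  obtain ⟨R, x, h1, -, -, h4, h5⟩ := hG.exists_path (s := s) (u := v) (T := {t}) h
    (fun h => ht.1 h.symm) (fun h => ht.2 h.symm) ⟨t, rfl⟩
  change Link G v R x at h1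
  rw [Set.mem_singleton_iff] at h5
  subst h5
  cases R with
  | nil => exact ⟨x, ht.2, link_nil.1 h1⟩
  | cons y R => exact ⟨y, fun h => h4 (by simp [h]), (link_cons.1 h1).1⟩

/-- Two neighbors of a vertex `v` are joined by a path that avoids `v`; together with `v` it closes
to a cycle. -/
theorem IsVertexConnected.exists_isCycleList (hG : IsVertexConnected G 2) :
    ∃ l, IsCycleList G l := by
  have := hG.finite
  have : Nontrivial V := (Finite.one_lt_card_iff_nontrivial).1 (by have := hG.1; omega)
  obtain ⟨v, s, hvs⟩ := exists_pair_ne V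
  obtain ⟨a, -, ha⟩ := hG.exists_adj_ne hvs
  obtain ⟨b, hba, hb⟩ := hG.exists_adj_ne ha.ne
  obtain ⟨R, x, h1, h2, h3, h4, h5⟩ := hG.exists_path (s := v) (u := a) (T := {b}) ha.ne'
    (fun h => hba h.symm) (fun h => hb.ne h) ⟨b, rfl⟩
  rw [Set.mem_singleton_iff] at h5
  subst h5
  refine ⟨v :: (a :: R ++ x :: []), isCycleList_cons_append.2 ⟨by simp, ?_, ?_, ?_⟩⟩
  · have := ha.ne
    have := hb.ne
    simp only [List.nodup_append, List.nodup_cons, List.mem_append, List.mem_cons,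
      Set.mem_singleton_iff, List.cons_append] at *
    grind
  · exact link_cons.2 ⟨ha, h1⟩
  · simpa using hb.symm

theorem IsVertexConnected.exists_isLongest (hG : IsVertexConnected G 2) :
    ∃ l, IsLongest G l := by
  classical
  have := hG.finite
  have := Fintype.ofFinite V
  obtain ⟨l₀, h₀⟩ := hG.exists_isCycleList
  let P : ℕ → Prop := fun n => ∃ l, IsCycleList G l ∧ l.length = n
  have hb : ∀ l, IsCycleList G l → l.length ≤ Fintype.card V :=
    fun l hl => hl.nodup.length_le_card
  obtain ⟨l, hl, hlen⟩ := Nat.findGreatest_spec (P := P) (hb l₀ h₀) ⟨l₀, h₀, rfl⟩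
  exact ⟨l, hl, fun l' hl' => hlen ▸ Nat.le_findGreatest (hb l' hl') ⟨l', hl', rfl⟩⟩

theorem length_le_cc [Finite V] {l : List V} (hn : l.Nodup) (h : ∀ v ∈ l, v ∈ covered G) :
    l.length ≤ cc G := by
  classical
  rw [cc_eq_ncard_covered, ← List.toFinset_card_of_nodup hn, ← Set.ncard_coe_finset]
  exact Set.ncard_le_ncard (fun v hv => h v (by simpa using hv)) (Set.toFinite _)

theorem IsLongest.subset_covered {l : List V} (h : IsLongest G l) {v : V} (hv : v ∈ l) :
    v ∈ covered G :=
  ⟨l, h, hv⟩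

theorem IsLongest.cc_eq_card {l : List V} (h : IsLongest G l)
    (hu : ∀ u, u ∉ l → u ∈ covered G) : cc G = Nat.card V := by
  rw [cc_eq_ncard_covered, ← Set.ncard_univ]
  congr 1
  refine Set.eq_univ_of_forall fun u => ?_
  by_cases hul : u ∈ l
  · exact h.subset_covered hul
  · exact hu u hul

theorem IsCycleList.exists_pair {l : List V} (h : IsCycleList G l) :
    ∃ a ∈ l, ∃ b ∈ l, a ≠ b := by
  obtain _ | ⟨a, _ | ⟨b, l⟩⟩ := l
  · simpa using h.three_le
  · simpa using h.three_le
  · exact ⟨a, by simp, b, by simp, fun e => by simpa [e] using h.nodup⟩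

theorem IsLongest.exists_isEar {l : List V} (h : IsLongest G l) (hG : IsVertexConnected G 2)
    {u : V} (hu : u ∉ l) : ∃ a m b, IsEar G l a m b ∧ u ∈ m := by
  obtain ⟨a, ha, b, hb, hab⟩ := h.1.exists_pair
  exact hG.exists_isEar ha hb hab hu

/-! ### Lower bound for girth at least 4 -/

/-- On a longest cycle of length at most 5 the arcs satisfy p + q ≤ 3, so the shorter one has at
most one inner vertex. As 1 ≤ m ≤ min(p, q), equality holds and every ear is covered. -/
theorem six_le_cc (hG : IsVertexConnected G 2) (hg : ((4 : ℕ) : ℕ∞) ≤ G.egirth)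
    (hn : 6 ≤ Nat.card V) : 6 ≤ cc G := by
  have := hG.finite
  obtain ⟨l, hl⟩ := hG.exists_isLongest
  by_cases h6 : 6 ≤ l.length
  · exact h6.trans (length_le_cc hl.1.nodup fun v => hl.subset_covered)
  rw [hl.cc_eq_card]
  · exact hn
  intro u hu
  obtain ⟨a, m, b, hm, hum⟩ := hl.exists_isEar hG hu
  have hpos := List.length_pos_of_mem hum
  obtain ⟨p, q, -, h1, h2, h3, h4, h5, h6⟩ := hl.ear_bounds hg hm (List.ne_nil_of_mem hum)
  exact h6 (by omega) u hum

/-! ### Chords of 6- and 7-cycles and the lower bound for girth at least 5 -/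

/-- A cyclic enumeration of the vertices of a cycle. -/
theorem IsCycleList.exists_fin {l : List V} (h : IsCycleList G l) {n : ℕ} (hn : l.length = n + 1) :
    ∃ p : Fin (n + 1) → V, Function.Injective p ∧ (∀ i, G.Adj (p i) (p (i + 1))) ∧
      ∀ v, v ∈ l ↔ ∃ i, p i = v := by
  refine ⟨fun i => l.get (i.cast hn.symm), ?_, ?_, ?_⟩
  · exact (List.nodup_iff_injective_get.1 h.nodup).comp (Fin.cast_injective _)
  · obtain _ | ⟨a, l⟩ := l
    · simp at hn
    intro i
    have hc := (isCycleList_cons.1 h).2.2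
    rw [List.isChain_iff_getElem] at hc
    have hl : l.length = n := by simpa using hn
    have := hc i.1 (by simp; omega)
    obtain ⟨i, hi⟩ := i
    -- The successor of index `n` in `Fin (n + 1)` is `0`, matching the final `a` of the closed
    -- chain.
    rcases Nat.lt_or_ge (i + 1) (n + 1) with hi' | hi'
    · have e : (⟨i, hi⟩ : Fin (n + 1)) + 1 = ⟨i + 1, hi'⟩ := by
        ext; simp [Fin.val_add, Nat.mod_eq_of_lt hi']
      rw [e]
      simp only [← List.cons_append] at this
      rw [List.getElem_append_left (by simp; omega), List.getElem_append_left (by omega)] at this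
      simpa using this
    · have hin : i = n := by omega
      have e : (⟨i, hi⟩ : Fin (n + 1)) + 1 = 0 := by
        ext; simp [Fin.val_add, hin]
      rw [e]
      simp only [← List.cons_append] at this
      rw [List.getElem_append_left (by simp; omega), List.getElem_append_right (by omega)] at this
      simpa using this
  · intro v
    rw [List.mem_iff_get]
    exact ⟨fun ⟨i, hi⟩ => ⟨i.cast hn, hi⟩, fun ⟨i, hi⟩ => ⟨_, hi⟩⟩

/-- A cyclic enumeration of the vertices of a cycle. -/
structure IsCyclic (G : SimpleGraph V) {n : ℕ} (p : Fin (n + 1) → V) : Prop where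
  injective : Function.Injective p
  adj_succ : ∀ i, G.Adj (p i) (p (i + 1))

/-- Moves a chosen vertex to index 0, so that the arguments below only distinguish the offset of a
second vertex. -/
theorem IsCyclic.shift {n : ℕ} {p : Fin (n + 1) → V} (h : IsCyclic G p) (i : Fin (n + 1)) :
    IsCyclic G fun k => p (i + k) where
  injective := h.injective.comp (add_right_injective i)
  adj_succ k := by simpa [add_assoc] using h.adj_succ (i + k)

theorem IsCyclic.adj {n : ℕ} {p : Fin (n + 1) → V} (h : IsCyclic G p) (i j : Fin (n + 1))
    (hij : j = i + 1 ∨ i = j + 1) : G.Adj (p i) (p j) := by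
  rcases hij with rfl | rfl
  · exact h.adj_succ i
  · exact (h.adj_succ j).symm

theorem not_triangle (hg : ((4 : ℕ) : ℕ∞) ≤ G.egirth) {a b c : V} (hab : G.Adj a b)
    (hbc : G.Adj b c) (hca : G.Adj c a) : False := by
  have h : IsCycleList G [a, b, c] := isCycleList_cons_link.2
    ⟨by simp, by simp [hab.ne, hbc.ne, hca.ne'], by simp [hab, hbc, hca]⟩
  simpa using natCast_le_egirth.1 hg _ h

theorem not_square (hg : ((5 : ℕ) : ℕ∞) ≤ G.egirth) {a b c d : V} (hac : a ≠ c) (hbd : b ≠ d)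
    (hab : G.Adj a b) (hbc : G.Adj b c) (hcd : G.Adj c d) (hda : G.Adj d a) : False := by
  have h : IsCycleList G [a, b, c, d] := isCycleList_cons_link.2
    ⟨by simp, by simp [hab.ne, hbc.ne, hcd.ne, hda.ne', hac, hbd], by simp [hab, hbc, hcd, hda]⟩
  simpa using natCast_le_egirth.1 hg _ h

theorem not_pentagon (hg : ((6 : ℕ) : ℕ∞) ≤ G.egirth) {a b c d e : V}
    (hn : [a, b, c, d, e].Nodup)
    (hab : G.Adj a b) (hbc : G.Adj b c) (hcd : G.Adj c d) (hde : G.Adj d e) (hea : G.Adj e a) :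
    False := by
  have h : IsCycleList G [a, b, c, d, e] := isCycleList_cons_link.2
    ⟨by simp, hn, by simp [hab, hbc, hcd, hde, hea]⟩
  simpa using natCast_le_egirth.1 hg _ h

/-- Two neighbors of `u` at distance 1 or 2 on the cycle would close a triangle or a 4-cycle with
`u`. -/
theorem IsCyclic.chord_six {p : Fin 6 → V} (hp : IsCyclic G p)
    (hg : ((5 : ℕ) : ℕ∞) ≤ G.egirth) {u : V} (hu : ∀ k, p k ≠ u) {i j : Fin 6} (hij : i ≠ j)
    (hi : G.Adj u (p i)) (hj : G.Adj u (p j)) : j = i + 3 := by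
  obtain ⟨t, rfl⟩ : ∃ t, j = i + t := ⟨j - i, by abel⟩
  have hq := hp.shift i
  have hi' : G.Adj u (p (i + 0)) := by simpa using hi
  generalize hqp : (fun k => p (i + k)) = q at hq
  have hqk : ∀ k, p (i + k) = q k := fun k => congrFun hqp k
  have hqu : ∀ k, q k ≠ u := fun k => hqk k ▸ hu _
  rw [hqk] at hi' hj
  have ht : t = 0 ∨ t = 1 ∨ t = 2 ∨ t = 3 ∨ t = 4 ∨ t = 5 := by clear * -; revert t; decide
  have key (k : Fin 6) (h : k ≠ 0) : q 0 ≠ q k := fun e => h (hq.injective e).symm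
  rcases ht with rfl | rfl | rfl | rfl | rfl | rfl
  · simp at hij
  · exact (not_triangle (le_trans (by norm_num) hg) hi' (hq.adj 0 1 (by decide)) hj.symm).elim
  · exact (not_square hg (hqu 1).symm (key 2 (by decide)) hi' (hq.adj 0 1 (by decide))
      (hq.adj 1 2 (by decide)) hj.symm).elim
  · rfl
  · exact (not_square hg (hqu 5).symm (key 4 (by decide)) hi' (hq.adj 0 5 (by decide))
      (hq.adj 5 4 (by decide)) hj.symm).elim
  · exact (not_triangle (le_trans (by norm_num) hg) hi' (hq.adj 0 5 (by decide)) hj.symm).elim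

theorem IsCyclic.chord_seven {p : Fin 7 → V} (hp : IsCyclic G p)
    (hg : ((5 : ℕ) : ℕ∞) ≤ G.egirth) {u : V} (hu : ∀ k, p k ≠ u) {i j : Fin 7} (hij : i ≠ j)
    (hi : G.Adj u (p i)) (hj : G.Adj u (p j)) : j = i + 3 ∨ i = j + 3 := by
  obtain ⟨t, rfl⟩ : ∃ t, j = i + t := ⟨j - i, by abel⟩
  have hq := hp.shift i
  have hi' : G.Adj u (p (i + 0)) := by simpa using hi
  generalize hqp : (fun k => p (i + k)) = q at hq
  have hqk : ∀ k, p (i + k) = q k := fun k => congrFun hqp k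
  have hqu : ∀ k, q k ≠ u := fun k => hqk k ▸ hu _
  rw [hqk] at hi' hj
  have ht : t = 0 ∨ t = 1 ∨ t = 2 ∨ t = 3 ∨ t = 4 ∨ t = 5 ∨ t = 6 := by clear * -; revert t; decide
  have key (k : Fin 7) (h : k ≠ 0) : q 0 ≠ q k := fun e => h (hq.injective e).symm
  rcases ht with rfl | rfl | rfl | rfl | rfl | rfl | rfl
  · simp at hij
  · exact (not_triangle (le_trans (by norm_num) hg) hi' (hq.adj 0 1 (by decide)) hj.symm).elim
  · exact (not_square hg (hqu 1).symm (key 2 (by decide)) hi' (hq.adj 0 1 (by decide))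
      (hq.adj 1 2 (by decide)) hj.symm).elim
  · exact Or.inl rfl
  · exact Or.inr (by clear * -; revert i; decide)
  · exact (not_square hg (hqu 6).symm (key 5 (by decide)) hi' (hq.adj 0 6 (by decide))
      (hq.adj 6 5 (by decide)) hj.symm).elim
  · exact (not_triangle (le_trans (by norm_num) hg) hi' (hq.adj 0 6 (by decide)) hj.symm).elim

/-- If `u` and `v` attach to the same antipodal pair, they form a 4-cycle with it. Otherwise the
attachments cross, and a cycle through `u`, `v` and all of the 6-cycle has length 8. -/
theorem IsCyclic.chords_six {p : Fin 6 → V} (hp : IsCyclic G p)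
    (hg : ((5 : ℕ) : ℕ∞) ≤ G.egirth) (hc : ∀ l, IsCycleList G l → l.length ≤ 6) {u v : V}
    (hu : ∀ k, p k ≠ u) (hv : ∀ k, p k ≠ v) (huv : u ≠ v) {i j : Fin 6}
    (h1 : G.Adj u (p i)) (h2 : G.Adj u (p (i + 3)))
    (h3 : G.Adj v (p j)) (h4 : G.Adj v (p (j + 3))) : False := by
  obtain ⟨t, rfl⟩ : ∃ t, j = i + t := ⟨j - i, by abel⟩
  have hq := hp.shift i
  replace h1 : G.Adj u (p (i + 0)) := by simpa using h1
  rw [add_assoc] at h4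
  generalize hqp : (fun k => p (i + k)) = q at hq
  have hqk : ∀ k, p (i + k) = q k := fun k => congrFun hqp k
  have hqu : ∀ k, q k ≠ u := fun k => hqk k ▸ hu _
  have hqv : ∀ k, q k ≠ v := fun k => hqk k ▸ hv _
  rw [hqk] at h1 h2 h3 h4
  have hqu' : ∀ k, u ≠ q k := fun k => (hqu k).symm
  have hqv' : ∀ k, v ≠ q k := fun k => (hqv k).symm
  have key (j k : Fin 6) (h : j ≠ k) : q j ≠ q k := fun e => h (hq.injective e)
  have ht : t = 0 ∨ t = 1 ∨ t = 2 ∨ t = 3 ∨ t = 4 ∨ t = 5 := by clear * -; revert t; decide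
  have cross1 (h3 : G.Adj v (q 1)) (h4 : G.Adj v (q 4)) : False := by
    have : IsCycleList G [q 0, u, q 3, q 2, q 1, v, q 4, q 5] := isCycleList_cons_link.2
      ⟨by simp, by simp [hq.injective.eq_iff, hqu, hqv, hqu', hqv', huv], by
        simp only [link_cons, link_nil]
        exact ⟨h1.symm, h2, hq.adj _ _ (by decide), hq.adj _ _ (by decide), h3.symm, h4,
          hq.adj _ _ (by decide), hq.adj _ _ (by decide)⟩⟩
    simpa using hc _ this
  have cross2 (h3 : G.Adj v (q 2)) (h4 : G.Adj v (q 5)) : False := by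
    have : IsCycleList G [q 0, u, q 3, q 4, q 5, v, q 2, q 1] := isCycleList_cons_link.2
      ⟨by simp, by simp [hq.injective.eq_iff, hqu, hqv, hqu', hqv', huv], by
        simp only [link_cons, link_nil]
        exact ⟨h1.symm, h2, hq.adj _ _ (by decide), hq.adj _ _ (by decide), h4.symm, h3,
          hq.adj _ _ (by decide), hq.adj _ _ (by decide)⟩⟩
    simpa using hc _ this
  rcases ht with rfl | rfl | rfl | rfl | rfl | rfl
  · exact not_square hg huv (key 0 3 (by decide)) h1 h3.symm h4 h2.symm
  · exact cross1 h3 h4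
  · exact cross2 h3 h4
  · exact not_square hg huv (key 3 0 (by decide)) h2 h3.symm h4 h1.symm
  · exact cross1 h4 h3
  · exact cross2 h4 h3

/-- Offset 0 gives a 4-cycle through `u` and `v`; offsets 1 and 6 give a 9-cycle, offsets 2 and 5 an
8-cycle. In the two surviving offsets the attachments share exactly one vertex of the cycle. -/
theorem IsCyclic.chords_seven {p : Fin 7 → V} (hp : IsCyclic G p)
    (hg : ((5 : ℕ) : ℕ∞) ≤ G.egirth) (hc : ∀ l, IsCycleList G l → l.length ≤ 7) {u v : V}
    (hu : ∀ k, p k ≠ u) (hv : ∀ k, p k ≠ v) (huv : u ≠ v) {i j : Fin 7}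
    (h1 : G.Adj u (p i)) (h2 : G.Adj u (p (i + 3)))
    (h3 : G.Adj v (p j)) (h4 : G.Adj v (p (j + 3))) : j = i + 3 ∨ j = i + 4 := by
  obtain ⟨t, rfl⟩ : ∃ t, j = i + t := ⟨j - i, by abel⟩
  have hq := hp.shift i
  replace h1 : G.Adj u (p (i + 0)) := by simpa using h1
  rw [add_assoc] at h4
  generalize hqp : (fun k => p (i + k)) = q at hq
  have hqk : ∀ k, p (i + k) = q k := fun k => congrFun hqp k
  have hqu : ∀ k, q k ≠ u := fun k => hqk k ▸ hu _
  have hqv : ∀ k, q k ≠ v := fun k => hqk k ▸ hv _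
  rw [hqk] at h1 h2 h3 h4
  have hqu' : ∀ k, u ≠ q k := fun k => (hqu k).symm
  have hqv' : ∀ k, v ≠ q k := fun k => (hqv k).symm
  have key (j k : Fin 7) (h : j ≠ k) : q j ≠ q k := fun e => h (hq.injective e)
  have ht : t = 0 ∨ t = 1 ∨ t = 2 ∨ t = 3 ∨ t = 4 ∨ t = 5 ∨ t = 6 := by clear * -; revert t; decide
  have long (l : List V) (h : IsCycleList G l) (hl : 7 < l.length) : False :=
    absurd (hc l h) (by omega)
  rcases ht with rfl | rfl | rfl | rfl | rfl | rfl | rfl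
  · exact (not_square hg huv (key 0 3 (by decide)) h1 h3.symm h4 h2.symm).elim
  · refine (long [q 0, u, q 3, q 2, q 1, v, q 4, q 5, q 6] (isCycleList_cons_link.2
      ⟨by simp, by simp [hq.injective.eq_iff, hqu, hqv, hqu', hqv', huv], ?_⟩) (by simp)).elim
    simp only [link_cons, link_nil]
    exact ⟨h1.symm, h2, hq.adj _ _ (by decide), hq.adj _ _ (by decide), h3.symm, h4,
      hq.adj _ _ (by decide), hq.adj _ _ (by decide), hq.adj _ _ (by decide)⟩
  · refine (long [q 0, u, q 3, q 4, q 5, v, q 2, q 1] (isCycleList_cons_link.2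
      ⟨by simp, by simp [hq.injective.eq_iff, hqu, hqv, hqu', hqv', huv], ?_⟩) (by simp)).elim
    simp only [link_cons, link_nil]
    exact ⟨h1.symm, h2, hq.adj _ _ (by decide), hq.adj _ _ (by decide), h4.symm, h3,
      hq.adj _ _ (by decide), hq.adj _ _ (by decide)⟩
  · exact Or.inl rfl
  · exact Or.inr rfl
  · refine (long [q 0, u, q 3, q 2, q 1, v, q 5, q 6] (isCycleList_cons_link.2
      ⟨by simp, by simp [hq.injective.eq_iff, hqu, hqv, hqu', hqv', huv], ?_⟩) (by simp)).elim
    simp only [link_cons, link_nil]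
    exact ⟨h1.symm, h2, hq.adj _ _ (by decide), hq.adj _ _ (by decide), h4.symm, h3,
      hq.adj _ _ (by decide), hq.adj _ _ (by decide)⟩
  · refine (long [q 0, u, q 3, q 4, q 5, q 6, v, q 2, q 1] (isCycleList_cons_link.2
      ⟨by simp, by simp [hq.injective.eq_iff, hqu, hqv, hqu', hqv', huv], ?_⟩) (by simp)).elim
    simp only [link_cons, link_nil]
    exact ⟨h1.symm, h2, hq.adj _ _ (by decide), hq.adj _ _ (by decide), hq.adj _ _ (by decide),
      h3.symm, h4, hq.adj _ _ (by decide), hq.adj _ _ (by decide)⟩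

theorem exists_nodup_not_mem [Finite V] {l : List V} (hl : l.Nodup) (k : ℕ)
    (h : l.length + k ≤ Nat.card V) :
    ∃ r : List V, r.Nodup ∧ r.length = k ∧ ∀ x ∈ r, x ∉ l := by
  classical
  have := Fintype.ofFinite V
  obtain ⟨t, ht, htk⟩ := Finset.exists_subset_card_eq (s := l.toFinsetᶜ) (n := k) (by
    rw [Finset.card_compl, List.toFinset_card_of_nodup hl, ← Nat.card_eq_fintype_card]
    omega)
  refine ⟨t.toList, t.nodup_toList, by simpa using htk, fun x hx => ?_⟩
  simpa using ht (Finset.mem_toList.1 hx)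

/-- With fewer than 8 covered vertices, every vertex off the longest cycle is a one-vertex ear. At
least three vertices are off the cycle, too many for the restrictions on pairs of such ears. -/
theorem eight_le_cc (hG : IsVertexConnected G 2) (hg : ((5 : ℕ) : ℕ∞) ≤ G.egirth)
    (hn : 10 ≤ Nat.card V) : 8 ≤ cc G := by
  have := hG.finite
  obtain ⟨l, hl⟩ := hG.exists_isLongest
  by_contra hcc
  have hlcc := length_le_cc hl.1.nodup fun v => hl.subset_covered
  have ears : ∀ u, u ∉ l → (l.length = 6 ∨ l.length = 7) ∧
      ∃ a ∈ l, ∃ b ∈ l, a ≠ b ∧ G.Adj u a ∧ G.Adj u b := by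
    intro u hu
    obtain ⟨a, m, b, hm, hum⟩ := hl.exists_isEar hG hu
    have hpos := List.length_pos_of_mem hum
    obtain ⟨p, q, -, h1, h2, h3, h4, h5, h6⟩ := hl.ear_bounds hg hm (List.ne_nil_of_mem hum)
    -- In the case of equality girth 5 gives 2m + 2 ≥ 5, so m ≥ 2 and p, q ≥ 2. The cycle and the
    -- ear then cover p + q + 2 + m ≥ 8 vertices.
    have hne : ¬ (m.length = p.length ∨ m.length = q.length) := by
      intro h
      have := length_le_cc (G := G) (l := l ++ m) (by
        rw [List.nodup_append]
        exact ⟨hl.1.nodup, hm.nodup, fun x hx y hy e => hm.not_mem y hy (e ▸ hx)⟩) (by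
        intro v hv
        rcases List.mem_append.1 hv with hv | hv
        · exact hl.subset_covered hv
        · exact h6 h v hv)
      rw [List.length_append] at this
      omega
    have hm1 : m.length = 1 := by omega
    obtain ⟨x, rfl⟩ := List.length_eq_one_iff.1 hm1
    obtain rfl : u = x := by simpa using hum
    have hlink := hm.link
    simp only [link_cons, link_nil] at hlink
    exact ⟨by omega, a, hm.left_mem, b, hm.right_mem, hm.ne, hlink.1.symm, hlink.2⟩
  obtain ⟨r, hr, hr3, hrl⟩ := exists_nodup_not_mem hl.1.nodup 3 (by omega)
  obtain ⟨u, v, w, rfl⟩ := List.length_eq_three.1 hr3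
  have hu := hrl u (by simp)
  have hv := hrl v (by simp)
  have hw := hrl w (by simp)
  simp only [List.nodup_cons, List.mem_cons, not_or, List.not_mem_nil, not_false_eq_true] at hr
  rcases (ears u hu).1 with h6 | h7
  · obtain ⟨p, hp, hadj, hmem⟩ := hl.1.exists_fin (n := 5) h6
    have hpc : IsCyclic G p := ⟨hp, hadj⟩
    have hout : ∀ x, x ∉ l → ∀ k, p k ≠ x := fun x hx k e => hx ((hmem x).2 ⟨k, e⟩)
    have chord : ∀ x, x ∉ l → ∃ i, G.Adj x (p i) ∧ G.Adj x (p (i + 3)) := by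
      intro x hx
      obtain ⟨-, a, ha, b, hb, hab, h1, h2⟩ := ears x hx
      obtain ⟨i, rfl⟩ := (hmem a).1 ha
      obtain ⟨j, rfl⟩ := (hmem b).1 hb
      have := hpc.chord_six hg (hout x hx) (fun e => hab (congrArg p e)) h1 h2
      exact ⟨i, h1, this ▸ h2⟩
    obtain ⟨i, hi, hi'⟩ := chord u hu
    obtain ⟨j, hj, hj'⟩ := chord v hv
    exact hpc.chords_six hg (fun l' hl' => h6 ▸ hl.2 l' hl') (hout u hu) (hout v hv) hr.1.1
      hi hi' hj hj'
  · obtain ⟨p, hp, hadj, hmem⟩ := hl.1.exists_fin (n := 6) h7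
    have hpc : IsCyclic G p := ⟨hp, hadj⟩
    have hout : ∀ x, x ∉ l → ∀ k, p k ≠ x := fun x hx k e => hx ((hmem x).2 ⟨k, e⟩)
    have chord : ∀ x, x ∉ l → ∃ i, G.Adj x (p i) ∧ G.Adj x (p (i + 3)) := by
      intro x hx
      obtain ⟨-, a, ha, b, hb, hab, h1, h2⟩ := ears x hx
      obtain ⟨i, rfl⟩ := (hmem a).1 ha
      obtain ⟨j, rfl⟩ := (hmem b).1 hb
      rcases hpc.chord_seven hg (hout x hx) (fun e => hab (congrArg p e)) h1 h2 with h | h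
      · exact ⟨i, h1, h ▸ h2⟩
      · exact ⟨j, h2, h ▸ h1⟩
    obtain ⟨i, hi, hi'⟩ := chord u hu
    obtain ⟨j, hj, hj'⟩ := chord v hv
    obtain ⟨k, hk, hk'⟩ := chord w hw
    have hlen : ∀ l', IsCycleList G l' → l'.length ≤ 7 := fun l' hl' => h7 ▸ hl.2 l' hl'
    have e1 := hpc.chords_seven hg hlen (hout u hu) (hout v hv) hr.1.1 hi hi' hj hj'
    have e2 := hpc.chords_seven hg hlen (hout u hu) (hout w hw) hr.1.2.1 hi hi' hk hk'
    have e3 := hpc.chords_seven hg hlen (hout v hv) (hout w hw) hr.2.1.1 hj hj' hk hk'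
    -- Three residues modulo 7 cannot differ pairwise by ±3.
    have : ∀ i j k : Fin 7, (j = i + 3 ∨ j = i + 4) → (k = i + 3 ∨ k = i + 4) →
      ¬ (k = j + 3 ∨ k = j + 4) := by decide
    exact this i j k e1 e2 e3

/-! ### Antipodal ears of an octagon and the lower bound for girth at least 6 and odd order -/

/-- An ear with at most two inner vertices that joins two antipodal vertices of an 8-cycle. -/
structure IsAntipodalEar (G : SimpleGraph V) (p : Fin 8 → V) (i : Fin 8) (m : List V) : Prop where
  nodup : m.Nodup
  ne_of_mem : ∀ x ∈ m, ∀ k, p k ≠ x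
  link : Link G (p i) m (p (i + 4))
  one_le : 1 ≤ m.length
  le_two : m.length ≤ 2

theorem IsAntipodalEar.reverse {p : Fin 8 → V} {i : Fin 8} {m : List V}
    (h : IsAntipodalEar G p i m) : IsAntipodalEar G p (i + 4) m.reverse where
  nodup := List.nodup_reverse.2 h.nodup
  ne_of_mem := fun x hx => h.ne_of_mem x (List.mem_reverse.1 hx)
  link := by
    have := h.link.symm
    rwa [show i + 4 + 4 = i by clear * -; revert i; decide]
  one_le := by simpa using h.one_le
  le_two := by simpa using h.le_two

/-- With at most two inner vertices, each of them is next to an end. This allows two ears with a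
common vertex to be compared through `IsIsolatedOctagon.chord`. -/
theorem IsAntipodalEar.adj {p : Fin 8 → V} {i : Fin 8} {m : List V}
    (h : IsAntipodalEar G p i m) {x : V} (hx : x ∈ m) :
    G.Adj x (p i) ∨ G.Adj x (p (i + 4)) := by
  have h1 := h.one_le
  have h2 := h.le_two
  have hl := h.link
  obtain _ | ⟨a, _ | ⟨b, _ | ⟨c, m⟩⟩⟩ := m
  · simp at hx
  · obtain rfl : x = a := by simpa using hx
    exact Or.inl (link_cons.1 hl).1.symm
  · simp only [link_cons, link_nil] at hl
    rcases List.mem_cons.1 hx with rfl | hx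
    · exact Or.inl hl.1.symm
    · obtain rfl : x = b := by simpa using hx
      exact Or.inr hl.2.2
  · simp at h2

/-- An 8-cycle in a graph of girth at least 6 such that no other cycle of length at least 8 leaves
its vertex set. -/
structure IsIsolatedOctagon (G : SimpleGraph V) (p : Fin 8 → V) : Prop where
  cyclic : IsCyclic G p
  egirth : ((6 : ℕ) : ℕ∞) ≤ G.egirth
  exists_eq : ∀ l, IsCycleList G l → 8 ≤ l.length → ∀ x ∈ l, ∃ k, p k = x

theorem IsIsolatedOctagon.shift {p : Fin 8 → V} (h : IsIsolatedOctagon G p) (i : Fin 8) :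
    IsIsolatedOctagon G fun k => p (i + k) where
  cyclic := h.cyclic.shift i
  egirth := h.egirth
  exists_eq l hl h8 x hx := by
    obtain ⟨k, hk⟩ := h.exists_eq l hl h8 x hx
    exact ⟨k - i, by simpa using hk⟩

/-- Neighbors of `u` at distance 1, 2 or 3 on the octagon would close a cycle of length 3, 4 or 5.
-/
theorem IsIsolatedOctagon.chord {p : Fin 8 → V} (hp : IsIsolatedOctagon G p) {u : V}
    (hu : ∀ k, p k ≠ u) {i j : Fin 8} (hi : G.Adj u (p i)) (hj : G.Adj u (p j)) :
    j = i ∨ j = i + 4 := by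
  obtain ⟨t, rfl⟩ : ∃ t, j = i + t := ⟨j - i, by abel⟩
  have hq := (hp.shift i).cyclic
  have hg := hp.egirth
  have hi' : G.Adj u (p (i + 0)) := by simpa using hi
  generalize hqp : (fun k => p (i + k)) = q at hq
  have hqk : ∀ k, p (i + k) = q k := fun k => congrFun hqp k
  have hqu : ∀ k, u ≠ q k := fun k => (hqk k ▸ hu _).symm
  rw [hqk] at hi' hj
  have ht : t = 0 ∨ t = 1 ∨ t = 2 ∨ t = 3 ∨ t = 4 ∨ t = 5 ∨ t = 6 ∨ t = 7 := by
    clear * -; revert t; decide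
  have key (k : Fin 8) (h : k ≠ 0) : q 0 ≠ q k := fun e => h (hq.injective e).symm
  have h4 : ((4 : ℕ) : ℕ∞) ≤ G.egirth := le_trans (by norm_num) hg
  have h5 : ((5 : ℕ) : ℕ∞) ≤ G.egirth := le_trans (by norm_num) hg
  rcases ht with rfl | rfl | rfl | rfl | rfl | rfl | rfl | rfl
  · simp
  · exact (not_triangle h4 hi' (hq.adj 0 1 (by decide)) hj.symm).elim
  · exact (not_square h5 (hqu 1) (key 2 (by decide)) hi' (hq.adj 0 1 (by decide))
      (hq.adj 1 2 (by decide)) hj.symm).elim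
  · exact (not_pentagon hg (by simp [hqu, hq.injective.eq_iff]) hi' (hq.adj 0 1 (by decide))
      (hq.adj 1 2 (by decide)) (hq.adj 2 3 (by decide)) hj.symm).elim
  · exact Or.inr rfl
  · exact (not_pentagon hg (by simp [hqu, hq.injective.eq_iff]) hi' (hq.adj 0 7 (by decide))
      (hq.adj 7 6 (by decide)) (hq.adj 6 5 (by decide)) hj.symm).elim
  · exact (not_square h5 (hqu 7) (key 6 (by decide)) hi' (hq.adj 0 7 (by decide))
      (hq.adj 7 6 (by decide)) hj.symm).elim
  · exact (not_triangle h4 hi' (hq.adj 0 7 (by decide)) hj.symm).elim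

/-- Ends at distance 1 or 2 close a cycle of length 4 or 5. Ends at distance 3 close, with the
longer arc, an 8-cycle that leaves the octagon. -/
theorem IsIsolatedOctagon.two_ear {p : Fin 8 → V} (hp : IsIsolatedOctagon G p) {u v : V}
    (hu : ∀ k, p k ≠ u) (hv : ∀ k, p k ≠ v) (huv : G.Adj u v) {i j : Fin 8} (hij : i ≠ j)
    (hi : G.Adj u (p i)) (hj : G.Adj v (p j)) : j = i + 4 := by
  obtain ⟨t, rfl⟩ : ∃ t, j = i + t := ⟨j - i, by abel⟩
  have hs := hp.shift i
  have hg := hp.egirth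
  have hi' : G.Adj u (p (i + 0)) := by simpa using hi
  generalize hqp : (fun k => p (i + k)) = q at hs
  have hq := hs.cyclic
  have hqk : ∀ k, p (i + k) = q k := fun k => congrFun hqp k
  have hqu : ∀ k, u ≠ q k := fun k => (hqk k ▸ hu _).symm
  have hqv : ∀ k, v ≠ q k := fun k => (hqk k ▸ hv _).symm
  have hqu' : ∀ k, q k ≠ u := fun k => (hqu k).symm
  rw [hqk] at hi' hj
  have ht : t = 0 ∨ t = 1 ∨ t = 2 ∨ t = 3 ∨ t = 4 ∨ t = 5 ∨ t = 6 ∨ t = 7 := by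
    clear * -; revert t; decide
  have h5 : ((5 : ℕ) : ℕ∞) ≤ G.egirth := le_trans (by norm_num) hg
  have hne := huv.ne
  have long (l : List V) (h : IsCycleList G (u :: l)) (hl : 7 ≤ l.length) : False := by
    obtain ⟨k, hk⟩ := hs.exists_eq _ h (by simpa using hl) u (by simp)
    exact hqu k hk.symm
  rcases ht with rfl | rfl | rfl | rfl | rfl | rfl | rfl | rfl
  · simp at hij
  · exact (not_square h5 (hqu 1) (hqv 0) huv hj (hq.adj 1 0 (by decide)) hi'.symm).elim
  · exact (not_pentagon hg (by simp [hqu, hqv, hne, hq.injective.eq_iff]) huv hj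
      (hq.adj 2 1 (by decide)) (hq.adj 1 0 (by decide)) hi'.symm).elim
  · refine (long [v, q 3, q 4, q 5, q 6, q 7, q 0] (isCycleList_cons_link.2
      ⟨by simp, by simp [hqu, hqv, hne, hq.injective.eq_iff], ?_⟩) (by simp)).elim
    simp only [link_cons, link_nil]
    exact ⟨huv, hj, hq.adj _ _ (by decide), hq.adj _ _ (by decide), hq.adj _ _ (by decide),
      hq.adj _ _ (by decide), hq.adj _ _ (by decide), hi'.symm⟩
  · rfl
  · refine (long [v, q 5, q 4, q 3, q 2, q 1, q 0] (isCycleList_cons_link.2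
      ⟨by simp, by simp [hqu, hqv, hne, hq.injective.eq_iff], ?_⟩) (by simp)).elim
    simp only [link_cons, link_nil]
    exact ⟨huv, hj, hq.adj _ _ (by decide), hq.adj _ _ (by decide), hq.adj _ _ (by decide),
      hq.adj _ _ (by decide), hq.adj _ _ (by decide), hi'.symm⟩
  · exact (not_pentagon hg (by simp [hqu, hqv, hne, hq.injective.eq_iff]) huv hj
      (hq.adj 6 7 (by decide)) (hq.adj 7 0 (by decide)) hi'.symm).elim
  · exact (not_square h5 (hqu 7) (hqv 0) huv hj (hq.adj 7 0 (by decide)) hi'.symm).elim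

/-- Crossing disjoint ears combine into one cycle. For `t = 1` and `t = 3` it uses all eight octagon
vertices, for `t = 2` six of them; with at least one vertex from each ear its length is at least 8,
although it leaves the octagon. -/
theorem IsIsolatedOctagon.not_crossing {q : Fin 8 → V} (hs : IsIsolatedOctagon G q)
    {m m' : List V} {t : Fin 8} (h : IsAntipodalEar G q 0 m) (h' : IsAntipodalEar G q t m')
    (hd : ∀ x ∈ m, x ∉ m') (ht : t = 1 ∨ t = 2 ∨ t = 3) : False := by
  have hq := hs.cyclic
  have hl := h.link
  have hl' := h'.link
  have h1 := h.one_le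
  have h1' := h'.one_le
  have hm : ∀ k, q k ∉ m := fun k hk => h.ne_of_mem _ hk k rfl
  have hm' : ∀ k, q k ∉ m' := fun k hk => h'.ne_of_mem _ hk k rfl
  have hn := h.nodup
  have hn' := h'.nodup
  have hd' : ∀ x ∈ m', x ∉ m := fun x hx hxm => hd x hxm hx
  have hmne : ∀ k, ∀ a ∈ m, q k ≠ a := fun k a ha e => hm k (e ▸ ha)
  have hmne' : ∀ k, ∀ a ∈ m', a ≠ q k := fun k a ha e => hm' k (e ▸ ha)
  have long (l : List V) (h : IsCycleList G (q 0 :: (m ++ q 4 :: l)))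
      (hl : 7 ≤ m.length + 1 + l.length) : False := by
    obtain ⟨x, hx⟩ := List.exists_mem_of_length_pos h1
    obtain ⟨k, hk⟩ := hs.exists_eq _ h (by simp; omega) x (by simp [hx])
    exact hm k (hk ▸ hx)
  rcases ht with rfl | rfl | rfl
  · refine long (q 3 :: q 2 :: q 1 :: (m' ++ q 5 :: [q 6, q 7]))
      (isCycleList_cons_append.2 ⟨by simp; omega, ?_, hl, ?_⟩) (by simp; omega)
    · simp [List.nodup_append, hq.injective.eq_iff, hm, hm', hn, hn']
      grind
    · simp only [link_cons, link_append, link_nil]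
      exact ⟨hq.adj _ _ (by decide), hq.adj _ _ (by decide), hq.adj _ _ (by decide), hl',
        hq.adj _ _ (by decide), hq.adj _ _ (by decide), hq.adj _ _ (by decide)⟩
  · refine long (q 3 :: q 2 :: (m' ++ q 6 :: [q 7]))
      (isCycleList_cons_append.2 ⟨by simp; omega, ?_, hl, ?_⟩) (by simp; omega)
    · simp [List.nodup_append, hq.injective.eq_iff, hm, hm', hn, hn']
      grind
    · simp only [link_cons, link_append, link_nil]
      exact ⟨hq.adj _ _ (by decide), hq.adj _ _ (by decide), hl',
        hq.adj _ _ (by decide), hq.adj _ _ (by decide)⟩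
  · refine long (q 5 :: q 6 :: q 7 :: (m'.reverse ++ q 3 :: [q 2, q 1]))
      (isCycleList_cons_append.2 ⟨by simp; omega, ?_, hl, ?_⟩) (by simp; omega)
    · simp [List.nodup_append, hq.injective.eq_iff, hm, hm', hn, hn']
      grind
    · simp only [link_cons, link_append, link_nil, link_reverse]
      exact ⟨hq.adj _ _ (by decide), hq.adj _ _ (by decide), hq.adj _ _ (by decide), hl',
        hq.adj _ _ (by decide), hq.adj _ _ (by decide), hq.adj _ _ (by decide)⟩

/-- All antipodal ears of an isolated octagon join the same two vertices. -/
theorem IsIsolatedOctagon.eq_or_eq {p : Fin 8 → V} (hp : IsIsolatedOctagon G p)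
    {m m' : List V} {i j : Fin 8} (h : IsAntipodalEar G p i m) (h' : IsAntipodalEar G p j m') :
    j = i ∨ j = i + 4 := by
  by_cases hd : ∀ x ∈ m, x ∉ m'
  · have hsh : ∀ {i j : Fin 8} {m m' : List V}, IsAntipodalEar G p i m →
        IsAntipodalEar G p j m' → (∀ x ∈ m, x ∉ m') →
        ¬ (j = i + 1 ∨ j = i + 2 ∨ j = i + 3) := by
      intro i j m m' h h' hd hij
      have e (i j : Fin 8) : i + (j - i + 4) = j + 4 := by
        abel
      refine (hp.shift i).not_crossing (t := j - i) (m := m) (m' := m')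
        ⟨h.nodup, fun x hx k => h.ne_of_mem x hx _, by simpa using h.link, h.one_le, h.le_two⟩
        ⟨h'.nodup, fun x hx k => h'.ne_of_mem x hx _, by simpa [e] using h'.link, h'.one_le,
          h'.le_two⟩ hd ?_
      rcases hij with rfl | rfl | rfl <;> simp
    -- Reversing the second ear replaces `j` by `j + 4`, so the two applications exclude the offsets
    -- 1, 2, 3 and 5, 6, 7.
    have h1 := hsh h h' hd
    have h2 := hsh h h'.reverse (by simpa using hd)
    clear * - h1 h2
    revert i j
    decide
  · push Not at hd
    obtain ⟨x, hx, hx'⟩ := hd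
    have hxp := h.ne_of_mem x hx
    rcases h.adj hx with h1 | h1 <;> rcases h'.adj hx' with h2 | h2 <;>
      have h3 := hp.chord hxp h1 h2 <;> clear * - h3 <;> revert i j <;> decide

/-- The number of vertices outside of an isolated octagon is even if there are two of them and they
all lie on antipodal ears. -/
theorem IsIsolatedOctagon.even [Fintype V] [DecidableEq V] {q : Fin 8 → V}
    (hq : IsIsolatedOctagon G q) {O : Finset V} (hO : ∀ x, x ∈ O ↔ ∀ k, q k ≠ x)
    (hcard : 1 < O.card) (hear : ∀ u ∈ O, ∃ m, IsAntipodalEar G q 0 m ∧ u ∈ m) :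
    Even O.card := by
  have hg := hq.egirth
  have h4 : ((4 : ℕ) : ℕ∞) ≤ G.egirth := le_trans (by norm_num) hg
  have h5 : ((5 : ℕ) : ℕ∞) ≤ G.egirth := le_trans (by norm_num) hg
  have h04 : q 0 ≠ q 4 := fun e => absurd (hq.cyclic.injective e) (by decide)
  have two : ∀ m, IsAntipodalEar G q 0 m → ∀ u ∈ m, m = [u] ∨ ∃ v ∈ O, G.Adj u v ∧
      (G.Adj u (q 0) ∧ G.Adj v (q 4) ∨ G.Adj v (q 0) ∧ G.Adj u (q 4)) := by
    intro m hm u hu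
    have h1 := hm.one_le
    have h2 := hm.le_two
    have hl := hm.link
    have hne := hm.ne_of_mem
    obtain _ | ⟨a, _ | ⟨b, _ | ⟨c, m⟩⟩⟩ := m
    · simp at hu
    · left
      simp at hu
      rw [hu]
    · right
      simp only [link_cons, link_nil, zero_add] at hl
      rcases List.mem_cons.1 hu with rfl | hu
      · exact ⟨b, (hO b).2 (hne b (by simp)), hl.2.1, Or.inl ⟨hl.1.symm, hl.2.2⟩⟩
      · obtain rfl : u = b := by simpa using hu
        exact ⟨a, (hO a).2 (hne a (by simp)), hl.2.1.symm, Or.inr ⟨hl.1.symm, hl.2.2⟩⟩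
    · simp at h2
  -- A one-vertex ear through `x` and a second outside vertex `u` are incompatible. If `u` is also a
  -- one-vertex ear, there is a 4-cycle; if it lies on a two-vertex ear, there is a pentagon, or a
  -- triangle when that ear contains `x`.
  have single : ∀ x, ¬ IsAntipodalEar G q 0 [x] := by
    intro x hx
    obtain ⟨hx0, hx4⟩ : G.Adj (q 0) x ∧ G.Adj x (q 4) := by simpa using hx.link
    have hxq := hx.ne_of_mem x (by simp)
    obtain ⟨u, hu, hux⟩ := Finset.exists_mem_ne hcard x
    have pent : ∀ y ∈ O, ∀ z ∈ O, G.Adj y z → G.Adj y (q 0) → G.Adj z (q 4) → False := by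
      intro y hy z hz hyz hy0 hz4
      by_cases hxy : x = y
      · subst hxy
        exact not_triangle h4 hyz hz4 hx4.symm
      by_cases hxz : x = z
      · subst hxz
        exact not_triangle h4 hyz hx0.symm hy0.symm
      have hy' := (hO y).1 hy
      have hz' := (hO z).1 hz
      exact not_pentagon hg (by
        simp [h04, hxq, hy', hz', hxy, hxz, hyz.ne', (hxq _).symm])
        hx0 hx4 hz4.symm hyz.symm hy0
    obtain ⟨m, hm, hum⟩ := hear u hu
    rcases two m hm u hum with rfl | ⟨v, hv, huv, ⟨h1, h2⟩ | ⟨h1, h2⟩⟩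
    · obtain ⟨hu0, hu4⟩ : G.Adj (q 0) u ∧ G.Adj u (q 4) := by simpa using hm.link
      exact not_square h5 hux h04 hu0.symm hx0 hx4 hu4.symm
    · exact pent u hu v hv huv h1 h2
    · exact pent v hv u hu huv.symm h1 h2
  have partner : ∀ u ∈ O, ∃ v ∈ O, G.Adj u v ∧
      (G.Adj u (q 0) ∧ G.Adj v (q 4) ∨ G.Adj v (q 0) ∧ G.Adj u (q 4)) := by
    intro u hu
    obtain ⟨m, hm, hum⟩ := hear u hu
    rcases two m hm u hum with rfl | h
    · exact (single u hm).elim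
    · exact h
  choose! f hfO hfadj hfq using partner
  -- If `f (f u) ≠ u`, consider which of `q 0`, `q 4` is adjacent to `u`, `f u` and `f (f u)`: some
  -- choice closes a triangle with `u` and `f u`, or a 4-cycle with all three.
  have hinv : ∀ u ∈ O, f (f u) = u := by
    intro u hu
    have hv := hfO u hu
    have a1 := hfadj u hu
    have a2 := hfadj (f u) hv
    by_contra hne
    rcases hfq u hu with ⟨b1, b2⟩ | ⟨b1, b2⟩ <;> rcases hfq (f u) hv with ⟨c1, c2⟩ | ⟨c1, c2⟩
    · exact not_triangle h4 a1 c1 b1.symm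
    · exact not_square h5 (fun e => hne e.symm) ((hO _).1 hv 0).symm a1 a2 c1 b1.symm
    · exact not_square h5 (fun e => hne e.symm) ((hO _).1 hv 4).symm a1 a2 c2 b2.symm
    · exact not_triangle h4 a1 c2 b2.symm
  -- The partner map is an involution without fixed points, so the terms cancel in pairs modulo 2.
  have hsum : ∑ x ∈ O, (1 : ZMod 2) = 0 :=
    Finset.sum_involution (fun x _ => f x) (fun x _ => by decide)
      (fun x hx _ => (hfadj x hx).ne') (fun x hx => hfO x hx) (fun x hx => hinv x hx)
  rw [Finset.sum_const, nsmul_eq_mul, mul_one] at hsum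
  exact (ZMod.natCast_eq_zero_iff_even).1 hsum

theorem nine_le_cc (hG : IsVertexConnected G 2) (hg : ((6 : ℕ) : ℕ∞) ≤ G.egirth)
    (hn : 10 ≤ Nat.card V) (hodd : Odd (Nat.card V)) : 9 ≤ cc G := by
  classical
  have := hG.finite
  have := Fintype.ofFinite V
  obtain ⟨l, hl⟩ := hG.exists_isLongest
  by_contra hcc
  have hlcc := length_le_cc hl.1.nodup fun v => hl.subset_covered
  by_cases hl8 : l.length ≤ 7
  -- Here p + q ≤ 5, so the shorter arc has at most 2 inner vertices, while girth 6 asks for a sum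
  -- of at least 4 with m. Hence m equals that arc and every ear is covered.
  · rw [hl.cc_eq_card] at hcc
    · omega
    intro u hu
    obtain ⟨a, m, b, hm, hum⟩ := hl.exists_isEar hG hu
    have hpos := List.length_pos_of_mem hum
    obtain ⟨p, q, -, h1, h2, h3, h4, h5, h6⟩ := hl.ear_bounds hg hm (List.ne_nil_of_mem hum)
    exact h6 (by omega) u hum
  have h8 : l.length = 8 := by omega
  have hcov : ∀ x ∈ covered G, x ∈ l := by
    intro x hx
    by_contra hxl
    have := length_le_cc (G := G) (l := x :: l) (List.nodup_cons.2 ⟨hxl, hl.1.nodup⟩) (by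
      intro v hv
      rcases List.mem_cons.1 hv with rfl | hv
      · exact hx
      · exact hl.subset_covered hv)
    rw [List.length_cons] at this
    omega
  obtain ⟨p, hp, hadj, hmem⟩ := hl.1.exists_fin (n := 7) h8
  have hout : ∀ x, x ∉ l ↔ ∀ k, p k ≠ x := fun x => by rw [hmem]; push Not; rfl
  have hoct : IsIsolatedOctagon G p := by
    refine ⟨⟨hp, hadj⟩, hg, fun l' hl' h8' x hx => (hmem x).1 (hcov x ⟨l', ?_, hx⟩)⟩
    exact hl.of_length_eq hl' (le_antisymm (hl.2 l' hl') (h8 ▸ h8'))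
  have ears : ∀ u, u ∉ l → ∃ i m, IsAntipodalEar G p i m ∧ u ∈ m := by
    intro u hu
    obtain ⟨a, m, b, hm, hum⟩ := hl.exists_isEar hG hu
    have hpos := List.length_pos_of_mem hum
    obtain ⟨p', q', -, h1, h2, h3, h4, h5, h6⟩ := hl.ear_bounds hg hm (List.ne_nil_of_mem hum)
    have hne : ¬ (m.length = p'.length ∨ m.length = q'.length) :=
      fun h => hu (hcov u (h6 h u hum))
    obtain ⟨i, rfl⟩ := (hmem a).1 hm.left_mem
    obtain ⟨j, rfl⟩ := (hmem b).1 hm.right_mem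
    -- The ear is strictly shorter than both arcs, and p' + q' = 6.
    have hm2 : m.length ≤ 2 := by omega
    have hij : i ≠ j := fun e => hm.ne (congrArg p e)
    have hmp : ∀ x ∈ m, ∀ k, p k ≠ x := fun x hx => (hout x).1 (hm.not_mem x hx)
    suffices hj : j = i + 4 from ⟨i, m, ⟨hm.nodup, hmp, hj ▸ hm.link, hpos, hm2⟩, hum⟩
    have hlink := hm.link
    obtain _ | ⟨x, _ | ⟨y, _ | ⟨z, m⟩⟩⟩ := m
    · simp at hum
    · simp only [link_cons, link_nil] at hlink
      exact (hoct.chord (hmp x (by simp)) hlink.1.symm hlink.2).resolve_left hij.symm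
    · simp only [link_cons, link_nil] at hlink
      exact hoct.two_ear (hmp x (by simp)) (hmp y (by simp)) hlink.2.1 hij hlink.1.symm hlink.2.2
    · simp at hm2
  have hOcard : (l.toFinsetᶜ).card + 8 = Nat.card V := by
    rw [Finset.card_compl, List.toFinset_card_of_nodup hl.1.nodup, ← Nat.card_eq_fintype_card]
    omega
  obtain ⟨u, hu⟩ := Finset.card_pos.1 (show 0 < (l.toFinsetᶜ).card by omega)
  obtain ⟨i, m, hm, -⟩ := ears u (by simpa using hu)
  have heven : Even (l.toFinsetᶜ).card := by
    refine (hoct.shift i).even (O := l.toFinsetᶜ) (fun x => ?_) (by omega) (fun x hx => ?_)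
    · rw [Finset.mem_compl, List.mem_toFinset, hout]
      exact ⟨fun h k => h _, fun h k => by simpa using h (k - i)⟩
    · obtain ⟨j, m', hm', hx'⟩ := ears x (by simpa using hx)
      -- All ears have the same two ends; those that start at the opposite one are reversed.
      obtain ⟨m'', hm'', hx''⟩ : ∃ m'', IsAntipodalEar G p i m'' ∧ x ∈ m'' := by
        rcases hoct.eq_or_eq hm hm' with rfl | rfl
        · exact ⟨m', hm', hx'⟩
        · refine ⟨m'.reverse, ?_, by simpa using hx'⟩
          have := hm'.reverse
          rwa [show i + 4 + 4 = i by clear * -; revert i; decide] at this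
      exact ⟨m'', ⟨hm''.nodup, fun x hx k => hm''.ne_of_mem x hx _, by simpa using hm''.link,
        hm''.one_le, hm''.le_two⟩, hx''⟩
  rw [← hOcard] at hodd
  rw [← Nat.not_even_iff_odd] at hodd
  exact hodd (heven.add (by decide))

/-! ### A criterion for 2-connectedness -/

theorem reachable_induce_of_isChain {T : Set V} :
    ∀ (l : List V), List.IsChain G.Adj l → (∀ v ∈ l, v ∈ T) →
      ∀ (u b : T), (u : V) ∈ l → (b : V) ∈ l → (G.induce T).Reachable u b
  | [], _, _, _, _, hu, _ => by simp at hu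
  | [a], _, _, u, b, hu, hb => by
    obtain rfl : u = b := Subtype.ext (by simp at hu hb; rw [hu, hb])
    rfl
  | a :: c :: l, hc, hT, u, b, hu, hb => by
    rw [List.isChain_cons_cons] at hc
    have ih := reachable_induce_of_isChain (c :: l) hc.2 (fun v hv => hT v (by simp [hv]))
    have hac : (G.induce T).Reachable ⟨a, hT a (by simp)⟩ ⟨c, hT c (by simp)⟩ :=
      SimpleGraph.Adj.reachable (by simpa using hc.1)
    have key : ∀ z : T, (z : V) ∈ a :: c :: l →
        (G.induce T).Reachable z ⟨c, hT c (by simp)⟩ := by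
      intro z hz
      rcases List.mem_cons.1 hz with h | h
      · have : z = ⟨a, hT a (by simp)⟩ := Subtype.ext h
        rw [this]
        exact hac
      · exact ih z _ h (by simp)
    exact (key u hu).trans (key b hb).symm

/-- At most one vertex is deleted. If it lies on the cycle, rotating it to the front shows that the
rest is a path. -/
theorem IsCycleList.reachable_induce {l : List V} (h : IsCycleList G l) {S : Finset V}
    (hS : S.card < 2) (u b : ((S : Set V)ᶜ : Set V)) (hu : (u : V) ∈ l) (hb : (b : V) ∈ l) :
    (G.induce ((S : Set V)ᶜ)).Reachable u b := by
  by_cases hl : ∀ v ∈ l, v ∉ S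
  · refine reachable_induce_of_isChain l ?_ (by simpa using hl) u b hu hb
    obtain _ | ⟨a, l⟩ := l
    · simp
    · have := (isCycleList_cons.1 h).2.2
      rw [← List.cons_append] at this
      exact this.left_of_append
  · push Not at hl
    obtain ⟨v, hv, hvS⟩ := hl
    obtain rfl : S = {v} := by
      refine Finset.eq_singleton_iff_unique_mem.2 ⟨hvS, fun w hw => ?_⟩
      exact Finset.card_le_one.1 (by omega) w hw v hvS
    obtain ⟨s, t, rfl⟩ := List.append_of_mem hv
    have hr : s ++ v :: t ~r v :: (t ++ s) := by
      simpa using List.isRotated_append (l := s) (l' := v :: t)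
    obtain ⟨-, h2, h3⟩ := isCycleList_cons.1 (h.of_isRotated hr)
    have mem : ∀ z : (((({v} : Finset V) : Set V)ᶜ : Set V)), (z : V) ∈ s ++ v :: t →
        (z : V) ∈ t ++ s := by
      intro z hz
      exact (List.mem_cons.1 (hr.mem_iff.1 hz)).resolve_left (by simpa using z.2)
    refine reachable_induce_of_isChain (t ++ s) ?_ ?_ u b (mem u hu) (mem b hb)
    · exact (List.IsChain.of_cons h3).left_of_append
    · intro w hw
      have := (List.nodup_cons.1 h2).1
      simp only [Finset.coe_singleton, Set.mem_compl_iff, Set.mem_singleton_iff]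
      exact fun e => this (e ▸ hw)

/-- After one deletion `x` or `y` remains, and every remaining vertex reaches it along its own
cycle. -/
theorem isVertexConnected_two_of_cycles {x y : V} (hxy : x ≠ y) (hcard : 2 < Nat.card V)
    (h : ∀ u, ∃ l, IsCycleList G l ∧ x ∈ l ∧ y ∈ l ∧ u ∈ l) : IsVertexConnected G 2 := by
  refine ⟨hcard, fun S hS => ?_⟩
  obtain ⟨b, hbS, hb⟩ : ∃ b, b ∉ S ∧ (b = x ∨ b = y) := by
    by_cases hx : x ∈ S
    · refine ⟨y, fun hy => ?_, Or.inr rfl⟩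
      exact hxy (Finset.card_le_one.1 (by omega) x hx y hy)
    · exact ⟨x, hx, Or.inl rfl⟩
  let b' : ((S : Set V)ᶜ : Set V) := ⟨b, by simpa using hbS⟩
  have key : ∀ u, (G.induce ((S : Set V)ᶜ)).Reachable u b' := by
    intro u
    obtain ⟨l, hl, hx, hy, hu⟩ := h u
    exact hl.reachable_induce hS u b' hu (by rcases hb with rfl | rfl <;> assumption)
  exact { preconnected := fun u v => (key u).trans (key v).symm, nonempty := ⟨b'⟩ }

/-! ### Cycles in systems of internally disjoint paths -/

/-- The edges of a cycle form a 2-regular symmetric relation on its vertices. -/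
structure IsTwoRegular (C : V → V → Prop) (S : Set V) : Prop where
  symm : ∀ u v, C u v → C v u
  mem : ∀ u v, C u v → v ∈ S
  two : ∀ v ∈ S, {w | C v w}.ncard = 2

/-- Forgets the cyclic order and keeps only that two cycle edges meet at each vertex. This local
information is enough to determine the vertex set of a cycle in the examples. -/
theorem IsCycleList.exists_isTwoRegular {l : List V} (h : IsCycleList G l) :
    ∃ C : V → V → Prop, IsTwoRegular C {v | v ∈ l} ∧ ∀ u v, C u v → G.Adj u v := by
  obtain ⟨a, w, hw, -, hs⟩ := h.exists_walk
  refine ⟨w.toSubgraph.Adj, ⟨fun u v h => h.symm, fun u v h => ?_, fun v hv => ?_⟩,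
    fun u v h => h.adj_sub⟩
  · exact (hs v).1 ((SimpleGraph.Walk.mem_verts_toSubgraph w).1 h.snd_mem)
  · exact hw.ncard_neighborSet_toSubgraph_eq_two ((hs v).2 hv)

theorem IsTwoRegular.exists_pair {C : V → V → Prop} {S : Set V} (h : IsTwoRegular C S) {v : V}
    (hv : v ∈ S) : ∃ a b, a ≠ b ∧ ∀ w, C v w ↔ w = a ∨ w = b := by
  obtain ⟨a, b, hab, e⟩ := Set.ncard_eq_two.1 (h.two v hv)
  refine ⟨a, b, hab, fun w => ?_⟩
  have : w ∈ {w | C v w} ↔ w ∈ ({a, b} : Set V) := by rw [e]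
  simpa using this

theorem IsTwoRegular.of_subset_pair {C : V → V → Prop} {S : Set V} (h : IsTwoRegular C S)
    {v a b : V} (hv : v ∈ S) (hab : ∀ w, C v w → w = a ∨ w = b) : C v a ∧ C v b := by
  obtain ⟨c, d, hcd, e⟩ := h.exists_pair hv
  have hc := hab c ((e c).2 (Or.inl rfl))
  have hd := hab d ((e d).2 (Or.inr rfl))
  rw [e, e]
  grind

/-- A 2-regular relation that meets the inside of a path whose inner vertices have no other
neighbors contains the whole path. -/
theorem IsTwoRegular.path {C : V → V → Prop} {S : Set V} (h : IsTwoRegular C S) {pt : ℕ → V}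
    {n : ℕ} (hpt : ∀ j, 0 < j → j < n → ∀ w, C (pt j) w → w = pt (j - 1) ∨ w = pt (j + 1))
    {j : ℕ} (hj0 : 0 < j) (hjn : j < n) (hj : pt j ∈ S) : ∀ k < n, C (pt k) (pt (k + 1)) := by
  have step : ∀ k, 0 < k → k < n → pt k ∈ S → C (pt k) (pt (k - 1)) ∧ C (pt k) (pt (k + 1)) :=
    fun k h0 hn hk => h.of_subset_pair hk (hpt k h0 hn)
  have up : ∀ d, j + d < n → pt (j + d) ∈ S := by
    intro d
    induction d with
    | zero => exact fun _ => hj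
    | succ d ih =>
      intro hd
      exact h.mem _ _ (step (j + d) (by omega) (by omega) (ih (by omega))).2
  have down : ∀ d, d < j → pt (j - d) ∈ S := by
    intro d
    induction d with
    | zero => exact fun _ => hj
    | succ d ih =>
      intro hd
      have := h.mem _ _ (step (j - d) (by omega) (by omega) (ih (by omega))).1
      rwa [Nat.sub_sub] at this
  have all : ∀ k, 0 < k → k < n → pt k ∈ S := by
    intro k h0 hn
    rcases le_total j k with hjk | hjk
    · have := up (k - j) (by omega)
      rwa [Nat.add_sub_cancel' hjk] at this
    · have := down (j - k) (by omega)
      rwa [Nat.sub_sub_self hjk] at this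
  intro k hk
  rcases Nat.eq_zero_or_pos k with rfl | h0
  · rcases Nat.lt_or_ge 1 n with h1 | h1
    · exact h.symm _ _ (step 1 one_pos h1 (all 1 one_pos h1)).1
    · omega
  · exact (step k h0 hk (all k h0 hk)).2

/-- Internally disjoint paths `pt i 0, …, pt i (len i)` from `x` to `y` in `G`. -/
structure ThetaPaths (G : SimpleGraph V) {ι : Type*} (len : ι → ℕ) (pt : ι → ℕ → V) (x y : V) :
    Prop where
  ne : x ≠ y
  two_le : ∀ i, 2 ≤ len i
  left : ∀ i, pt i 0 = x
  right : ∀ i, pt i (len i) = y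
  ne_left : ∀ i j, 0 < j → j < len i → pt i j ≠ x
  ne_right : ∀ i j, 0 < j → j < len i → pt i j ≠ y
  inj : ∀ i j i' j', 0 < j → j < len i → 0 < j' → j' < len i' → pt i j = pt i' j' →
    i = i' ∧ j = j'
  adj : ∀ i j, j < len i → G.Adj (pt i j) (pt i (j + 1))

section ThetaPaths

variable {ι : Type*} {len : ι → ℕ} {pt : ι → ℕ → V} {x y : V}

/-- The inner vertices of a path of a theta graph. -/
def inner (len : ι → ℕ) (pt : ι → ℕ → V) (i : ι) : List V :=
  (List.range (len i - 1)).map fun j => pt i (j + 1)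

/-- The cycle of a theta graph that consists of two of its paths. -/
def pairCycle (len : ι → ℕ) (pt : ι → ℕ → V) (x y : V) (i i' : ι) : List V :=
  x :: (inner len pt i ++ y :: (inner len pt i').reverse)

theorem mem_inner {i : ι} {v : V} :
    v ∈ inner len pt i ↔ ∃ j, 0 < j ∧ j < len i ∧ pt i j = v := by
  simp only [inner, List.mem_map, List.mem_range]
  constructor
  · rintro ⟨j, hj, rfl⟩
    exact ⟨j + 1, by omega, by omega, rfl⟩
  · rintro ⟨j, h0, hj, rfl⟩
    exact ⟨j - 1, by omega, by rw [Nat.sub_add_cancel h0]⟩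

theorem mem_pairCycle {i i' : ι} {v : V} :
    v ∈ pairCycle len pt x y i i' ↔
      v = x ∨ v = y ∨ v ∈ inner len pt i ∨ v ∈ inner len pt i' := by
  simp only [pairCycle, List.mem_cons, List.mem_append, List.mem_reverse]
  tauto

theorem link_map_range {p : ℕ → V} {n : ℕ} (h : ∀ j ≤ n, G.Adj (p j) (p (j + 1))) :
    Link G (p 0) ((List.range n).map fun j => p (j + 1)) (p (n + 1)) := by
  induction n with
  | zero => simpa using h 0 le_rfl
  | succ n ih =>
    rw [List.range_succ, List.map_append, List.map_singleton, link_append]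
    exact ⟨ih fun j hj => h j (by omega), by simpa using h (n + 1) le_rfl⟩

theorem ThetaPaths.nodup_inner (h : ThetaPaths G len pt x y) (i : ι) :
    (inner len pt i).Nodup := by
  refine List.Nodup.map_on ?_ List.nodup_range
  intro j hj k hk e
  rw [List.mem_range] at hj hk
  have := (h.inj i (j + 1) i (k + 1) (by omega) (by omega) (by omega) (by omega) e).2
  omega

theorem ThetaPaths.length_pairCycle (h : ThetaPaths G len pt x y) (i i' : ι) :
    (pairCycle len pt x y i i').length = len i + len i' := by
  have h1 := h.two_le i
  have h2 := h.two_le i'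
  simp only [pairCycle, inner, List.length_cons, List.length_append, List.length_map,
    List.length_range, List.length_reverse]
  omega

theorem ThetaPaths.link_inner (h : ThetaPaths G len pt x y) (i : ι) :
    Link G x (inner len pt i) y := by
  have h2 := h.two_le i
  have := link_map_range (G := G) (p := pt i) (n := len i - 1) fun j hj => h.adj i j (by omega)
  rwa [h.left, Nat.sub_add_cancel (by omega), h.right] at this

theorem ThetaPaths.isCycleList (h : ThetaPaths G len pt x y) {i i' : ι} (hi : i ≠ i') :
    IsCycleList G (pairCycle len pt x y i i') := by
  have hlen := h.length_pairCycle i i'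
  have h1 := h.two_le i
  have h2 := h.two_le i'
  refine isCycleList_cons_append.2 ⟨?_, ?_, h.link_inner i, (h.link_inner i').symm⟩
  · simp only [pairCycle, List.length_cons, List.length_append] at hlen
    omega
  · have n1 := h.nodup_inner i
    have n2 := h.nodup_inner i'
    have hx : ∀ i, x ∉ inner len pt i := by
      intro i hx
      obtain ⟨j, h0, hj, e⟩ := mem_inner.1 hx
      exact h.ne_left i j h0 hj e
    have hy : ∀ i, y ∉ inner len pt i := by
      intro i hy
      obtain ⟨j, h0, hj, e⟩ := mem_inner.1 hy
      exact h.ne_right i j h0 hj e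
    have hd : ∀ v ∈ inner len pt i, v ∉ inner len pt i' := by
      intro v hv hv'
      obtain ⟨j, h0, hj, e⟩ := mem_inner.1 hv
      obtain ⟨j', h0', hj', e'⟩ := mem_inner.1 hv'
      exact hi (h.inj i j i' j' h0 hj h0' hj' (e.trans e'.symm)).1
    have hxy := h.ne
    simp only [List.nodup_cons, List.nodup_append, List.mem_append, List.mem_cons,
      List.mem_reverse, List.nodup_reverse]
    grind

/-- A 2-regular relation on a system of paths is the union of two of the paths. -/
theorem ThetaPaths.exists_pair (h : ThetaPaths G len pt x y) {C : V → V → Prop} {S : Set V}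
    (hC : IsTwoRegular C S) (hne : S.Nonempty)
    (hS : ∀ v ∈ S, v = x ∨ v = y ∨ ∃ i, v ∈ inner len pt i)
    (hx : ∀ w, C x w → ∃ i, w = pt i 1) (hy : ∀ w, C y w → ∃ i, w = pt i (len i - 1))
    (hin : ∀ i j, 0 < j → j < len i → ∀ w, C (pt i j) w → w = pt i (j - 1) ∨ w = pt i (j + 1)) :
    ∃ i i', i ≠ i' ∧ ∀ v, v ∈ S ↔ v ∈ pairCycle len pt x y i i' := by
  have path : ∀ i v, v ∈ inner len pt i → v ∈ S → ∀ k < len i, C (pt i k) (pt i (k + 1)) := by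
    intro i v hv hvS
    obtain ⟨j, h0, hj, rfl⟩ := mem_inner.1 hv
    exact hC.path (hin i) h0 hj hvS
  have xpath : ∀ i v, v ∈ inner len pt i → v ∈ S → C x (pt i 1) := by
    intro i v hv hvS
    have := path i v hv hvS 0 (by have := h.two_le i; omega)
    rwa [h.left] at this
  have mem1 : ∀ i, pt i 1 ∈ inner len pt i :=
    fun i => mem_inner.2 ⟨1, one_pos, h.two_le i, rfl⟩
  -- An inner vertex of a path forces the whole path and so its end `x`; a cycle through `y` has an
  -- inner vertex next to `y`.
  have hxS : x ∈ S := by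
    have of_inner : ∀ i v, v ∈ inner len pt i → v ∈ S → x ∈ S :=
      fun i v hv hvS => hC.mem _ _ (hC.symm _ _ (xpath i v hv hvS))
    obtain ⟨v, hv⟩ := hne
    rcases hS v hv with rfl | rfl | ⟨i, hi⟩
    · exact hv
    · obtain ⟨a, _, -, ha⟩ := hC.exists_pair hv
      have hva := (ha a).2 (Or.inl rfl)
      obtain ⟨i, rfl⟩ := hy a hva
      have := h.two_le i
      exact of_inner i _ (mem_inner.2 ⟨len i - 1, by omega, by omega, rfl⟩) (hC.mem _ _ hva)
    · exact of_inner i v hi hv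
  obtain ⟨a, b, hab, hw⟩ := hC.exists_pair hxS
  have hxa := (hw a).2 (Or.inl rfl)
  have hxb := (hw b).2 (Or.inr rfl)
  obtain ⟨i, rfl⟩ := hx a hxa
  obtain ⟨i', rfl⟩ := hx b hxb
  have sub : ∀ i, pt i 1 ∈ S → y ∈ S ∧ ∀ v ∈ inner len pt i, v ∈ S := by
    intro i hi
    have hp := path i _ (mem1 i) hi
    have h2 := h.two_le i
    constructor
    · have := hC.mem _ _ (hp (len i - 1) (by omega))
      rwa [Nat.sub_add_cancel (by omega), h.right] at this
    · intro v hv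
      obtain ⟨j, h0, hj, rfl⟩ := mem_inner.1 hv
      have := hC.mem _ _ (hp (j - 1) (by omega))
      rwa [Nat.sub_add_cancel (by omega)] at this
  have hi := sub i (hC.mem _ _ hxa)
  have hi' := sub i' (hC.mem _ _ hxb)
  refine ⟨i, i', fun e => hab (e ▸ rfl), fun v => ?_⟩
  rw [mem_pairCycle]
  constructor
  · intro hv
    rcases hS v hv with rfl | rfl | ⟨k, hk⟩
    · exact Or.inl rfl
    · exact Or.inr (Or.inl rfl)
    -- A cycle vertex inside path `k` makes the first edge of that path one of the only two cycle
    -- edges at `x`.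
    · have h2 := h.two_le
      rcases (hw _).1 (xpath k v hk hv) with e | e
      · rw [(h.inj k 1 i 1 one_pos (h2 k) one_pos (h2 i) e).1] at hk
        exact Or.inr (Or.inr (Or.inl hk))
      · rw [(h.inj k 1 i' 1 one_pos (h2 k) one_pos (h2 i') e).1] at hk
        exact Or.inr (Or.inr (Or.inr hk))
  · rintro (rfl | rfl | hv | hv)
    · exact hxS
    · exact hi.1
    · exact hi.2 v hv
    · exact hi'.2 v hv

end ThetaPaths

/-- Hence knowing the vertex set of a cycle is enough to know its length. -/
theorem IsCycleList.length_eq {l l' : List V} (h : IsCycleList G l) (h' : IsCycleList G l')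
    (e : ∀ v, v ∈ l ↔ v ∈ l') : l.length = l'.length :=
  ((List.perm_ext_iff_of_nodup h.nodup h'.nodup).2 e).length_eq

/-- A graph all of whose longest cycles have the same vertices. -/
theorem isExample_of_cycles {n g c : ℕ} (hn : Nat.card V = n) (hG : IsVertexConnected G 2)
    (hg : ∃ l, IsCycleList G l ∧ l.length = g) (hc : ∃ l, IsCycleList G l ∧ l.length = c ∧
      ∀ l', IsCycleList G l' → g ≤ l'.length ∧ l'.length ≤ c ∧
        (l'.length = c → ∀ v ∈ l', v ∈ l)) : IsExample G n g c where
  order := hn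
  connected := hG
  girth := by
    obtain ⟨l₀, h₀, e₀⟩ := hg
    obtain ⟨l, hl, hlc, hmax⟩ := hc
    apply le_antisymm
    · obtain ⟨a, w, hw, hwl, -⟩ := h₀.exists_walk
      have := SimpleGraph.egirth_le_length hw
      rwa [hwl, e₀] at this
    · exact natCast_le_egirth.2 fun l' hl' => (hmax l' hl').1
  covering := by
    classical
    obtain ⟨l, hl, rfl, hmax⟩ := hc
    have hlong : IsLongest G l := ⟨hl, fun l' hl' => (hmax l' hl').2.1⟩
    have : covered G = (l.toFinset : Set V) := by
      ext v
      rw [List.coe_toFinset]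
      constructor
      · rintro ⟨l', hl', hv⟩
        exact (hmax l' hl'.1).2.2 (le_antisymm (hmax l' hl'.1).2.1 (hl'.2 l hl)) v hv
      · exact fun hv => hlong.subset_covered hv
    rw [cc_eq_ncard_covered, this, Set.ncard_coe_finset, List.toFinset_card_of_nodup hl.nodup]

/-! ### Theta graphs -/

theorem thetaPoint_zero (l : List ℕ) (i : Fin l.length) : thetaPoint l i 0 = Sum.inl false := by
  simp [thetaPoint]

theorem thetaPoint_inner (l : List ℕ) (i : Fin l.length) {j : ℕ} (h0 : 0 < j)
    (hj : j < l.get i) : thetaPoint l i j = Sum.inr ⟨i, ⟨j - 1, by omega⟩⟩ := by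
  have h : j - 1 < l.get i - 1 := by omega
  rw [thetaPoint, if_neg h0.ne', dif_pos h]

theorem thetaPoint_last (l : List ℕ) (i : Fin l.length) {j : ℕ} (h0 : 0 < j)
    (hj : l.get i ≤ j) : thetaPoint l i j = Sum.inl true := by
  have h : ¬ j - 1 < l.get i - 1 := by omega
  rw [thetaPoint, if_neg h0.ne', dif_neg h]

theorem thetaPoint_eq_left {l : List ℕ} {i : Fin l.length} {j : ℕ}
    (h : thetaPoint l i j = Sum.inl false) : j = 0 := by
  by_contra h0
  rcases Nat.lt_or_ge j (l.get i) with hj | hj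
  · simp [thetaPoint_inner l i (Nat.pos_of_ne_zero h0) hj] at h
  · simp [thetaPoint_last l i (Nat.pos_of_ne_zero h0) hj] at h

/-- Only an inequality is possible, as `thetaPoint` stays at the end vertex for larger indices. -/
theorem thetaPoint_eq_right {l : List ℕ} {i : Fin l.length} {j : ℕ}
    (h : thetaPoint l i j = Sum.inl true) : l.get i ≤ j := by
  by_contra hj
  rcases Nat.eq_zero_or_pos j with rfl | h0
  · simp [thetaPoint_zero] at h
  · simp [thetaPoint_inner l i h0 (not_le.1 hj)] at h

theorem thetaPoint_eq_inner {l : List ℕ} {i i' : Fin l.length} {j j' : ℕ} (h0 : 0 < j)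
    (hj : j < l.get i) (h : thetaPoint l i' j' = thetaPoint l i j) : i' = i ∧ j' = j := by
  rw [thetaPoint_inner l i h0 hj] at h
  rcases Nat.eq_zero_or_pos j' with rfl | h0'
  · simp [thetaPoint_zero] at h
  rcases Nat.lt_or_ge j' (l.get i') with hj' | hj'
  · rw [thetaPoint_inner l i' h0' hj', Sum.inr.injEq] at h
    obtain ⟨rfl, h⟩ := Sigma.mk.inj h
    have := congrArg Fin.val (eq_of_heq h)
    simp only at this
    exact ⟨rfl, by omega⟩
  · simp [thetaPoint_last l i' h0' hj'] at h

theorem thetaGraph_adj_iff {l : List ℕ} {u v : ThetaVertex l} :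
    (thetaGraph l).Adj u v ↔ u ≠ v ∧ ∃ (i : Fin l.length) (j : ℕ), j < l.get i ∧
      (u = thetaPoint l i j ∧ v = thetaPoint l i (j + 1) ∨
        v = thetaPoint l i j ∧ u = thetaPoint l i (j + 1)) := by
  rw [thetaGraph, SimpleGraph.fromRel_adj]
  refine and_congr_right fun _ => ⟨?_, ?_⟩
  · rintro (⟨i, j, h1, h2⟩ | ⟨i, j, h1, h2⟩)
    · exact ⟨i, j, h1, Or.inl h2⟩
    · exact ⟨i, j, h1, Or.inr h2⟩
  · rintro ⟨i, j, h1, h2 | h2⟩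
    · exact Or.inl ⟨i, j, h1, h2⟩
    · exact Or.inr ⟨i, j, h1, h2⟩

theorem thetaPaths {l : List ℕ} (hl : ∀ k ∈ l, 2 ≤ k) :
    ThetaPaths (thetaGraph l) l.get (thetaPoint l) (Sum.inl false) (Sum.inl true) where
  ne := by simp
  two_le i := hl _ (l.get_mem i)
  left := thetaPoint_zero l
  right i := thetaPoint_last l i (by have := hl _ (l.get_mem i); omega) le_rfl
  ne_left i j h0 _ h := by have := thetaPoint_eq_left h; omega
  ne_right i j _ hj h := by have := thetaPoint_eq_right h; omega
  inj i j i' j' _ _ h0 hj h := thetaPoint_eq_inner h0 hj h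
  adj i j hj := by
    refine thetaGraph_adj_iff.2 ⟨fun e => ?_, i, j, hj, Or.inl ⟨rfl, rfl⟩⟩
    have h2 := hl _ (l.get_mem i)
    rcases Nat.eq_zero_or_pos j with rfl | h0
    · have := (thetaPoint_eq_inner one_pos (by omega) e).2
      omega
    · have := (thetaPoint_eq_inner h0 hj e.symm).2
      omega

theorem thetaGraph_adj_left {l : List ℕ} {w : ThetaVertex l}
    (h : (thetaGraph l).Adj (Sum.inl false) w) : ∃ i, w = thetaPoint l i 1 := by
  obtain ⟨-, i, j, hj, ⟨h1, h2⟩ | ⟨h1, h2⟩⟩ := thetaGraph_adj_iff.1 h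
  · obtain rfl := thetaPoint_eq_left h1.symm
    exact ⟨i, h2⟩
  · have := thetaPoint_eq_left h2.symm
    omega

theorem thetaGraph_adj_right {l : List ℕ} {w : ThetaVertex l}
    (h : (thetaGraph l).Adj (Sum.inl true) w) : ∃ i, w = thetaPoint l i (l.get i - 1) := by
  obtain ⟨-, i, j, hj, ⟨h1, h2⟩ | ⟨h1, h2⟩⟩ := thetaGraph_adj_iff.1 h
  · have := thetaPoint_eq_right h1.symm
    omega
  · have := thetaPoint_eq_right h2.symm
    exact ⟨i, by rw [h1]; congr 1; omega⟩

theorem thetaGraph_adj_inner {l : List ℕ} {i : Fin l.length} {j : ℕ} (h0 : 0 < j)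
    (hj : j < l.get i) {w : ThetaVertex l} (h : (thetaGraph l).Adj (thetaPoint l i j) w) :
    w = thetaPoint l i (j - 1) ∨ w = thetaPoint l i (j + 1) := by
  obtain ⟨-, i', j', hj', ⟨h1, h2⟩ | ⟨h1, h2⟩⟩ := thetaGraph_adj_iff.1 h
  · obtain ⟨rfl, rfl⟩ := thetaPoint_eq_inner h0 hj h1.symm
    exact Or.inr h2
  · obtain ⟨rfl, rfl⟩ := thetaPoint_eq_inner h0 hj h2.symm
    exact Or.inl (by simpa using h1)

theorem thetaVertex_cases {l : List ℕ} (v : ThetaVertex l) :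
    v = Sum.inl false ∨ v = Sum.inl true ∨ ∃ i, v ∈ inner l.get (thetaPoint l) i := by
  rcases v with b | ⟨i, j⟩
  · cases b <;> simp
  · refine Or.inr (Or.inr ⟨i, mem_inner.2 ⟨j + 1, by omega, by omega, ?_⟩⟩)
    rw [thetaPoint_inner l i (by omega) (by omega)]
    simp

/-- Every cycle of a theta graph is the union of two of its paths. -/
theorem thetaGraph_exists_pair {l : List ℕ} (hl : ∀ k ∈ l, 2 ≤ k) {c : List (ThetaVertex l)}
    (hc : IsCycleList (thetaGraph l) c) :
    ∃ i i', i ≠ i' ∧ ∀ v, v ∈ c ↔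
      v ∈ pairCycle l.get (thetaPoint l) (Sum.inl false) (Sum.inl true) i i' := by
  obtain ⟨C, hC, hCG⟩ := hc.exists_isTwoRegular
  obtain ⟨v, hv⟩ := List.exists_mem_of_length_pos (l := c) (by have := hc.three_le; omega)
  exact (thetaPaths hl).exists_pair hC ⟨v, hv⟩ (fun v _ => thetaVertex_cases v)
    (fun w hw => thetaGraph_adj_left (hCG _ _ hw)) (fun w hw => thetaGraph_adj_right (hCG _ _ hw))
    (fun i j h0 hj w hw => thetaGraph_adj_inner h0 hj (hCG _ _ hw))

/-- The path containing `u` is paired with any other path; this feeds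
`isVertexConnected_two_of_cycles`. -/
theorem thetaGraph_exists_cycle {l : List ℕ} (hl : ∀ k ∈ l, 2 ≤ k) {a b : Fin l.length}
    (hab : a ≠ b) (u : ThetaVertex l) :
    ∃ c, IsCycleList (thetaGraph l) c ∧ Sum.inl false ∈ c ∧ Sum.inl true ∈ c ∧ u ∈ c := by
  obtain ⟨i, i', hi, hu⟩ : ∃ i i', i ≠ i' ∧
      u ∈ pairCycle l.get (thetaPoint l) (Sum.inl false) (Sum.inl true) i i' := by
    rcases thetaVertex_cases u with rfl | rfl | ⟨i, hi⟩
    · exact ⟨a, b, hab, mem_pairCycle.2 (by simp)⟩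
    · exact ⟨a, b, hab, mem_pairCycle.2 (by simp)⟩
    · by_cases h : i = a
      · exact ⟨i, b, h ▸ hab, mem_pairCycle.2 (by simp [hi])⟩
      · exact ⟨i, a, h, mem_pairCycle.2 (by simp [hi])⟩
  exact ⟨_, (thetaPaths hl).isCycleList hi, mem_pairCycle.2 (by simp),
    mem_pairCycle.2 (by simp), hu⟩

theorem card_thetaVertex (l : List ℕ) :
    Nat.card (ThetaVertex l) = 2 + (l.map (· - 1)).sum := by
  rw [Nat.card_eq_fintype_card, Fintype.card_sum, Fintype.card_bool, Fintype.card_sigma]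
  congr 1
  simp only [Fintype.card_fin]
  exact Fin.sum_univ_fun_getElem l (· - 1)

theorem IsCycleList.two_lt_card {V : Type*} [Finite V] {G : SimpleGraph V} {l : List V}
    (h : IsCycleList G l) : 2 < Nat.card V := by
  have := Fintype.ofFinite V
  have h1 := h.nodup.length_le_card
  have h2 := h.three_le
  rw [Nat.card_eq_fintype_card]
  omega

/-- A theta graph with two longest paths. -/
theorem thetaGraph_isExample {p q n g : ℕ} {t : List ℕ} (hl : ∀ k ∈ p :: q :: t, 2 ≤ k)
    (ht : ∀ k ∈ t, k < p ∧ k < q) (hn : 2 + ((p :: q :: t).map (· - 1)).sum = n)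
    (hg : (p :: q :: t).Pairwise fun a b => g ≤ a + b)
    (hg' : ∃ i i' : Fin (p :: q :: t).length, i ≠ i' ∧
      (p :: q :: t).get i + (p :: q :: t).get i' = g) :
    IsExample (thetaGraph (p :: q :: t)) n g (p + q) := by
  have h := thetaPaths hl
  let a : Fin (p :: q :: t).length := ⟨0, by simp⟩
  let b : Fin (p :: q :: t).length := ⟨1, by simp⟩
  have hab : a ≠ b := by simp [a, b]
  refine isExample_of_cycles ((card_thetaVertex _).trans hn)
    (isVertexConnected_two_of_cycles h.ne (h.isCycleList hab).two_lt_card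
      (thetaGraph_exists_cycle hl hab)) ?_
    ⟨_, h.isCycleList hab, h.length_pairCycle a b, fun c hc => ?_⟩
  · obtain ⟨i, i', hi, e⟩ := hg'
    exact ⟨_, h.isCycleList hi, (h.length_pairCycle i i').trans e⟩
  · obtain ⟨i, i', hi, hmem⟩ := thetaGraph_exists_pair hl hc
    have hlen := (hc.length_eq (h.isCycleList hi) hmem).trans (h.length_pairCycle i i')
    have get_cases : ∀ i : Fin (p :: q :: t).length, i = a ∨ i = b ∨
        ((p :: q :: t).get i < p ∧ (p :: q :: t).get i < q) := by
      rintro ⟨_ | _ | i, hi⟩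
      · exact Or.inl rfl
      · exact Or.inr (Or.inl rfl)
      · exact Or.inr (Or.inr (ht _ (by simp)))
    have ha : (p :: q :: t).get a = p := rfl
    have hb : (p :: q :: t).get b = q := rfl
    refine ⟨?_, ?_, ?_⟩
    · rw [hlen]
      rw [List.pairwise_iff_get] at hg
      rcases lt_or_gt_of_ne hi with hlt | hlt
      · exact hg i i' hlt
      · have := hg i' i hlt
        omega
    · rw [hlen]
      rcases get_cases i with rfl | rfl | h1 <;> rcases get_cases i' with rfl | rfl | h2 <;>
        first | exact absurd rfl hi | omega
    -- The other paths are shorter than both `p` and `q`, so length `p + q` leaves only the pair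
    -- `a`, `b` in one of its two orders, with the same vertex set.
    · intro hc' v hv
      rw [hlen] at hc'
      have hv' := (hmem v).1 hv
      rcases get_cases i with rfl | rfl | h1 <;> rcases get_cases i' with rfl | rfl | h2 <;>
        first | exact absurd rfl hi | exact hv' | omega | skip
      rw [mem_pairCycle] at hv' ⊢
      tauto

/-! ### Adding a subdivided edge -/

section addSubdividedEdge

variable {V : Type*} {G : SimpleGraph V} {x r : V}

theorem addSubdividedEdge_adj_some {a b : V} :
    (addSubdividedEdge G x r).Adj (some a) (some b) ↔ G.Adj a b := by
  rw [addSubdividedEdge, SimpleGraph.fromRel_adj]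
  constructor
  · rintro ⟨-, (⟨a', b', h, h1, h2⟩ | ⟨h, -⟩) | (⟨a', b', h, h1, h2⟩ | ⟨h, -⟩)⟩
    · rw [Option.some.inj h1, Option.some.inj h2]
      exact h
    · simp at h
    · rw [Option.some.inj h1, Option.some.inj h2]
      exact h.symm
    · simp at h
  · exact fun h => ⟨fun e => h.ne (Option.some.inj e), Or.inl (Or.inl ⟨a, b, h, rfl, rfl⟩)⟩

theorem addSubdividedEdge_adj_none {w : Option V} :
    (addSubdividedEdge G x r).Adj none w ↔ w = some x ∨ w = some r := by
  rw [addSubdividedEdge, SimpleGraph.fromRel_adj]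
  constructor
  · rintro ⟨-, (⟨a', b', h, h1, h2⟩ | ⟨-, h⟩) | (⟨a', b', h, h1, h2⟩ | ⟨h, h'⟩)⟩
    · simp at h1
    · exact h
    · simp at h2
    · rcases h' with h' | h' <;> simp at h'
  · intro h
    exact ⟨by rcases h with rfl | rfl <;> simp, Or.inl (Or.inr ⟨rfl, h⟩)⟩

theorem addSubdividedEdge_adj {a : V} {w : Option V}
    (h : (addSubdividedEdge G x r).Adj (some a) w) :
    (w = none ∧ (a = x ∨ a = r)) ∨ ∃ b, w = some b ∧ G.Adj a b := by
  cases w with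
  | none => exact Or.inl ⟨rfl, by simpa using addSubdividedEdge_adj_none.1 h.symm⟩
  | some b => exact Or.inr ⟨b, rfl, addSubdividedEdge_adj_some.1 h⟩

theorem ThetaPaths.map_some {ι : Type*} {len : ι → ℕ} {pt : ι → ℕ → V} {a b : V}
    (h : ThetaPaths G len pt a b) :
    ThetaPaths (addSubdividedEdge G x r) len (fun i j => some (pt i j)) (some a) (some b) where
  ne e := h.ne (Option.some.inj e)
  two_le := h.two_le
  left i := congrArg some (h.left i)
  right i := congrArg some (h.right i)
  ne_left i j h0 hj e := h.ne_left i j h0 hj (Option.some.inj e)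
  ne_right i j h0 hj e := h.ne_right i j h0 hj (Option.some.inj e)
  inj i j i' j' h0 hj h0' hj' e := h.inj i j i' j' h0 hj h0' hj' (Option.some.inj e)
  adj i j hj := addSubdividedEdge_adj_some.2 (h.adj i j hj)

end addSubdividedEdge

/-! ### The modified theta graph for girth 5 and even order -/

theorem two_le_lengths432 (m : ℕ) : ∀ k ∈ lengths432 m, 2 ≤ k := by
  intro k hk
  simp [List.mem_replicate] at hk
  omega

/-- The path of `θ(4², 3^m, 2)` to which an edge is added. -/
def firstPath (m : ℕ) : Fin (lengths432 m).length := ⟨0, Nat.succ_pos _⟩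

/-- The other path of length 4 of `θ(4², 3^m, 2)`. -/
def secondPath (m : ℕ) : Fin (lengths432 m).length := ⟨1, by simp⟩

theorem lengths432_cases {m : ℕ} (i : Fin (lengths432 m).length) :
    i = firstPath m ∨ i = secondPath m ∨ (lengths432 m).get i ≤ 3 := by
  obtain ⟨_ | _ | i, hi⟩ := i
  · exact Or.inl rfl
  · exact Or.inr (Or.inl rfl)
  · refine Or.inr (Or.inr ?_)
    have : (lengths432 m).get ⟨i + 2, hi⟩ ∈ List.replicate m 3 ++ [2] :=
      List.getElem_mem (l := List.replicate m 3 ++ [2]) (n := i) (by simpa using hi)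
    simp only [List.mem_append, List.mem_replicate, List.mem_singleton] at this
    rcases this with h | h
    · exact h.2.le
    · rw [h]
      omega

theorem pairwise_lengths432 (m : ℕ) : (lengths432 m).Pairwise fun a b => 5 ≤ a + b := by
  simp [lengths432, List.pairwise_append, List.pairwise_replicate, List.mem_replicate]
  grind

theorem five_le_lengths432 {m : ℕ} {i i' : Fin (lengths432 m).length} (h : i ≠ i') :
    5 ≤ (lengths432 m).get i + (lengths432 m).get i' := by
  have hp := List.pairwise_iff_get.1 (pairwise_lengths432 m)
  rcases lt_or_gt_of_ne h with hlt | hlt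
  · exact hp i i' hlt
  · have := hp i' i hlt
    omega

theorem thetaPaths432 (m : ℕ) : ThetaPaths (thetaGraph (lengths432 m)) (lengths432 m).get
    (thetaPoint (lengths432 m)) (Sum.inl false) (Sum.inl true) :=
  thetaPaths (two_le_lengths432 m)

/-- The path lengths of the subdivision `θ(4, 3^(m+1), 2)` inside `modifiedTheta m`. -/
def shortLen (m : ℕ) (i : Fin (lengths432 m).length) : ℕ :=
  if i = firstPath m then 3 else (lengths432 m).get i

/-- The paths of the theta graph obtained from `modifiedTheta m` by removing the vertices `p`
and `q`. -/
def shortPoint (m : ℕ) (i : Fin (lengths432 m).length) (j : ℕ) :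
    Option (ThetaVertex (lengths432 m)) :=
  if i = firstPath m then
    if j = 0 then some (Sum.inl false) else if j = 1 then none
    else some (thetaPoint (lengths432 m) (firstPath m) (j + 1))
  else some (thetaPoint (lengths432 m) i j)

section

variable {m : ℕ}

theorem shortLen_first : shortLen m (firstPath m) = 3 := if_pos rfl

theorem shortLen_ne {i : Fin (lengths432 m).length} (h : i ≠ firstPath m) :
    shortLen m i = (lengths432 m).get i := if_neg h

theorem shortPoint_ne {i : Fin (lengths432 m).length} (h : i ≠ firstPath m) (j : ℕ) :
    shortPoint m i j = some (thetaPoint (lengths432 m) i j) := if_neg h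

theorem shortPoint_zero : shortPoint m (firstPath m) 0 = some (Sum.inl false) := by
  simp [shortPoint]

theorem shortPoint_one : shortPoint m (firstPath m) 1 = none := by
  simp [shortPoint]

theorem shortPoint_two : shortPoint m (firstPath m) 2 =
    some (thetaPoint (lengths432 m) (firstPath m) 3) := by
  simp [shortPoint]

theorem thetaPoint_four : thetaPoint (lengths432 m) (firstPath m) 4 = Sum.inl true :=
  (thetaPaths432 m).right (firstPath m)

theorem shortPoint_three : shortPoint m (firstPath m) 3 = some (Sum.inl true) := by
  rw [← thetaPoint_four]
  simp [shortPoint]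

theorem get_first : (lengths432 m).get (firstPath m) = 4 := rfl

theorem get_second : (lengths432 m).get (secondPath m) = 4 := rfl

theorem modifiedTheta_adj_none {w : Option (ThetaVertex (lengths432 m))} :
    (modifiedTheta m).Adj none w ↔
      w = some (Sum.inl false) ∨ w = some (thetaPoint (lengths432 m) (firstPath m) 3) := by
  rw [← thetaPoint_zero _ (firstPath m)]
  exact addSubdividedEdge_adj_none

theorem modifiedTheta_adj_some {a b : ThetaVertex (lengths432 m)} :
    (modifiedTheta m).Adj (some a) (some b) ↔ (thetaGraph (lengths432 m)).Adj a b :=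
  addSubdividedEdge_adj_some

theorem modifiedTheta_adj {a : ThetaVertex (lengths432 m)}
    {w : Option (ThetaVertex (lengths432 m))} (h : (modifiedTheta m).Adj (some a) w) :
    (w = none ∧ (a = Sum.inl false ∨ a = thetaPoint (lengths432 m) (firstPath m) 3)) ∨
      ∃ b, w = some b ∧ (thetaGraph (lengths432 m)).Adj a b := by
  rw [← thetaPoint_zero _ (firstPath m)]
  exact addSubdividedEdge_adj h

/-- The excluded vertex is `r`, the only inner vertex that gains a neighbor. -/
theorem modifiedTheta_adj_inner {i : Fin (lengths432 m).length} {j : ℕ} (h0 : 0 < j)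
    (hj : j < (lengths432 m).get i) (hij : ¬ (i = firstPath m ∧ j = 3))
    {w : Option (ThetaVertex (lengths432 m))}
    (h : (modifiedTheta m).Adj (some (thetaPoint (lengths432 m) i j)) w) :
    w = some (thetaPoint (lengths432 m) i (j - 1)) ∨
      w = some (thetaPoint (lengths432 m) i (j + 1)) := by
  rcases modifiedTheta_adj h with ⟨-, e | e⟩ | ⟨b, rfl, hb⟩
  · exact absurd e ((thetaPaths432 m).ne_left i j h0 hj)
  · obtain ⟨rfl, rfl⟩ := thetaPoint_eq_inner (by omega) (by rw [get_first]; omega) e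
    exact absurd ⟨rfl, rfl⟩ hij
  · simpa using thetaGraph_adj_inner h0 hj hb

theorem modifiedTheta_adj_right {w : Option (ThetaVertex (lengths432 m))}
    (h : (modifiedTheta m).Adj (some (Sum.inl true)) w) :
    ∃ i, w = some (thetaPoint (lengths432 m) i ((lengths432 m).get i - 1)) := by
  rcases modifiedTheta_adj h with ⟨-, e | e⟩ | ⟨b, rfl, hb⟩
  · simp at e
  · exact absurd e.symm ((thetaPaths432 m).ne_right _ 3 (by omega) (by rw [get_first]; omega))
  · obtain ⟨i, rfl⟩ := thetaGraph_adj_right hb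
    exact ⟨i, rfl⟩

theorem modifiedTheta_adj_left {w : Option (ThetaVertex (lengths432 m))}
    (h : (modifiedTheta m).Adj (some (Sum.inl false)) w) :
    w = none ∨ ∃ i, w = some (thetaPoint (lengths432 m) i 1) := by
  rcases modifiedTheta_adj h with ⟨rfl, -⟩ | ⟨b, rfl, hb⟩
  · exact Or.inl rfl
  · obtain ⟨i, rfl⟩ := thetaGraph_adj_left hb
    exact Or.inr ⟨i, rfl⟩

theorem shortPoint_inner {i : Fin (lengths432 m).length} {j : ℕ} (h0 : 0 < j)
    (hj : j < shortLen m i) :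
    (i = firstPath m ∧ j = 1) ∨ (i = firstPath m ∧ j = 2) ∨
      (i ≠ firstPath m ∧ j < (lengths432 m).get i) := by
  by_cases h : i = firstPath m
  · rw [h, shortLen_first] at hj
    simp only [h, true_and, ne_eq, not_true_eq_false, false_and, or_false]
    omega
  · rw [shortLen_ne h] at hj
    exact Or.inr (Or.inr ⟨h, hj⟩)

theorem thetaPaths_short (m : ℕ) : ThetaPaths (modifiedTheta m) (shortLen m) (shortPoint m)
    (some (Sum.inl false)) (some (Sum.inl true)) where
  ne := by simp
  two_le i := by
    by_cases h : i = firstPath m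
    · rw [h, shortLen_first]; omega
    · rw [shortLen_ne h]; exact (thetaPaths432 m).two_le i
  left i := by
    by_cases h : i = firstPath m
    · rw [h, shortPoint_zero]
    · rw [shortPoint_ne h, thetaPoint_zero]
  right i := by
    by_cases h : i = firstPath m
    · rw [h, shortLen_first, shortPoint_three]
    · rw [shortLen_ne h, shortPoint_ne h, (thetaPaths432 m).right]
  ne_left i j h0 hj := by
    rcases shortPoint_inner h0 hj with ⟨rfl, rfl⟩ | ⟨rfl, rfl⟩ | ⟨h, hj⟩
    · simp [shortPoint_one]
    · rw [shortPoint_two]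
      exact fun e => (thetaPaths432 m).ne_left _ 3 (by omega) (by rw [get_first]; omega)
        (Option.some.inj e)
    · rw [shortPoint_ne h]
      exact fun e => (thetaPaths432 m).ne_left i j h0 hj (Option.some.inj e)
  ne_right i j h0 hj := by
    rcases shortPoint_inner h0 hj with ⟨rfl, rfl⟩ | ⟨rfl, rfl⟩ | ⟨h, hj⟩
    · simp [shortPoint_one]
    · rw [shortPoint_two]
      exact fun e => (thetaPaths432 m).ne_right _ 3 (by omega) (by rw [get_first]; omega)
        (Option.some.inj e)
    · rw [shortPoint_ne h]
      exact fun e => (thetaPaths432 m).ne_right i j h0 hj (Option.some.inj e)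
  inj i j i' j' h0 hj h0' hj' e := by
    rcases shortPoint_inner h0 hj with ⟨rfl, rfl⟩ | ⟨rfl, rfl⟩ | ⟨h, hj⟩ <;>
      rcases shortPoint_inner h0' hj' with ⟨rfl, rfl⟩ | ⟨rfl, rfl⟩ | ⟨h', hj'⟩ <;>
      try simp only [shortPoint_one, shortPoint_two, reduceCtorEq] at e
    · exact ⟨rfl, rfl⟩
    · simp [shortPoint_ne h'] at e
    · exact ⟨rfl, rfl⟩
    · rw [shortPoint_ne h', Option.some.injEq] at e
      exact absurd (thetaPoint_eq_inner h0' hj' e).1.symm h'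
    · simp [shortPoint_ne h] at e
    · rw [shortPoint_ne h, Option.some.injEq] at e
      exact absurd (thetaPoint_eq_inner h0 hj e.symm).1.symm h
    · rw [shortPoint_ne h, shortPoint_ne h', Option.some.injEq] at e
      exact thetaPoint_eq_inner h0' hj' e
  adj i j hj := by
    by_cases h : i = firstPath m
    · subst h
      rw [shortLen_first] at hj
      obtain rfl | rfl | rfl : j = 0 ∨ j = 1 ∨ j = 2 := by omega
      · rw [shortPoint_zero, shortPoint_one]
        exact (modifiedTheta_adj_none.2 (Or.inl rfl)).symm
      · rw [shortPoint_one, shortPoint_two]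
        exact modifiedTheta_adj_none.2 (Or.inr rfl)
      · rw [shortPoint_two, shortPoint_three, modifiedTheta_adj_some, ← thetaPoint_four]
        exact (thetaPaths432 m).adj _ 3 (by rw [get_first]; omega)
    · rw [shortLen_ne h] at hj
      rw [shortPoint_ne h, shortPoint_ne h, modifiedTheta_adj_some]
      exact (thetaPaths432 m).adj i j hj

/-- The cycle `z x p q r` of `modifiedTheta m`. -/
theorem isCycleList_pentagon (m : ℕ) : IsCycleList (modifiedTheta m)
    (none :: (List.range 4).map fun j => some (thetaPoint (lengths432 m) (firstPath m) j)) := by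
  have hadj : ∀ j < 4, (modifiedTheta m).Adj
      (some (thetaPoint (lengths432 m) (firstPath m) j))
      (some (thetaPoint (lengths432 m) (firstPath m) (j + 1))) :=
    fun j hj => modifiedTheta_adj_some.2 ((thetaPaths432 m).adj _ j hj)
  rw [isCycleList_cons_link]
  refine ⟨by simp, ?_, ?_⟩
  · refine List.nodup_cons.2 ⟨by simp, List.Nodup.map_on ?_ List.nodup_range⟩
    intro j hj k hk e
    rw [List.mem_range] at hj hk
    replace e := Option.some.inj e
    rcases Nat.eq_zero_or_pos k with rfl | h0
    · rw [thetaPoint_zero] at e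
      exact thetaPoint_eq_left e
    · exact (thetaPoint_eq_inner h0 (by rwa [get_first]) e).2
  · simp only [List.range_succ, List.range_zero, List.nil_append, List.map_cons, List.map_nil,
      List.cons_append, link_cons, link_nil]
    refine ⟨modifiedTheta_adj_none.2 (Or.inl (by rw [thetaPoint_zero])), hadj 0 (by omega),
      hadj 1 (by omega), hadj 2 (by omega), (modifiedTheta_adj_none.2 (Or.inr rfl)).symm⟩

theorem modifiedTheta_cases (v : Option (ThetaVertex (lengths432 m))) :
    v = none ∨ v = some (Sum.inl false) ∨ v = some (Sum.inl true) ∨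
      ∃ i j, 0 < j ∧ j < (lengths432 m).get i ∧ v = some (thetaPoint (lengths432 m) i j) := by
  obtain _ | v := v
  · exact Or.inl rfl
  · rcases thetaVertex_cases v with rfl | rfl | ⟨i, hi⟩
    · exact Or.inr (Or.inl rfl)
    · exact Or.inr (Or.inr (Or.inl rfl))
    · obtain ⟨j, h0, hj, rfl⟩ := mem_inner.1 hi
      exact Or.inr (Or.inr (Or.inr ⟨i, j, h0, hj, rfl⟩))

/-- A cycle that misses the new vertex is a cycle of the original theta graph. -/
theorem modifiedTheta_cycle_of_none_notMem {c : List (Option (ThetaVertex (lengths432 m)))}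
    (hc : IsCycleList (modifiedTheta m) c) (hz : none ∉ c) :
    ∃ i i', i ≠ i' ∧ ∀ v, v ∈ c ↔ v ∈ pairCycle (lengths432 m).get
      (fun i j => some (thetaPoint (lengths432 m) i j)) (some (Sum.inl false))
      (some (Sum.inl true)) i i' := by
  obtain ⟨C, hC, hCG⟩ := hc.exists_isTwoRegular
  obtain ⟨v, hv⟩ := List.exists_mem_of_length_pos (l := c) (by have := hc.three_le; omega)
  have hT : ThetaPaths (modifiedTheta m) (lengths432 m).get
    (fun i j => some (thetaPoint (lengths432 m) i j)) (some (Sum.inl false))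
      (some (Sum.inl true)) := (thetaPaths432 m).map_some
  have hne : ∀ u w, C u w → w ≠ none := fun u w h e => hz (e ▸ hC.mem u w h)
  refine hT.exists_pair hC ⟨v, hv⟩ (fun v hv => ?_) (fun w hw => ?_) (fun w hw => ?_)
    (fun i j h0 hj w hw => ?_)
  · rcases modifiedTheta_cases v with rfl | rfl | rfl | ⟨i, j, h0, hj, rfl⟩
    · exact absurd hv hz
    · exact Or.inl rfl
    · exact Or.inr (Or.inl rfl)
    · exact Or.inr (Or.inr ⟨i, mem_inner.2 ⟨j, h0, hj, rfl⟩⟩)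
  · exact (modifiedTheta_adj_left (hCG _ _ hw)).resolve_left (hne _ _ hw)
  · exact modifiedTheta_adj_right (hCG _ _ hw)
  · rcases modifiedTheta_adj (hCG _ _ hw) with ⟨e, -⟩ | ⟨b, rfl, hb⟩
    · exact absurd e (hne _ _ hw)
    · simpa using thetaGraph_adj_inner h0 hj hb

/-- The new vertex z has degree 2, so the cycle contains x z r. If it meets p or q, which also have
degree 2, it contains x p q r and closes up as the pentagon z x p q r. Otherwise it lies in the
theta graph in which x z r y replaces x p q r y. -/
theorem modifiedTheta_cycle_of_none_mem {c : List (Option (ThetaVertex (lengths432 m)))}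
    (hc : IsCycleList (modifiedTheta m) c) (hz : none ∈ c) :
    c.length = 5 ∨ ∃ i i', i ≠ i' ∧ ∀ v, v ∈ c ↔ v ∈ pairCycle (shortLen m) (shortPoint m)
      (some (Sum.inl false)) (some (Sum.inl true)) i i' := by
  obtain ⟨C, hC, hCG⟩ := hc.exists_isTwoRegular
  have hz1 := hC.of_subset_pair hz fun w hw => modifiedTheta_adj_none.1 (hCG _ _ hw)
  have other : ∀ i, i ≠ firstPath m → ∀ j, 0 < j → j < (lengths432 m).get i →
      some (thetaPoint (lengths432 m) i j) ∈ c →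
      C (some (Sum.inl false)) (some (thetaPoint (lengths432 m) i 1)) := by
    intro i hi j h0 hj hjc
    have := hC.path (pt := fun j => some (thetaPoint (lengths432 m) i j))
      (fun k h0 hk w hw => modifiedTheta_adj_inner h0 hk (fun h => hi h.1) (hCG _ _ hw)) h0 hj hjc
      0 (by omega)
    simpa [thetaPoint_zero] using this
  have first : ∀ j, 0 < j → j < 3 → some (thetaPoint (lengths432 m) (firstPath m) j) ∈ c →
      ∀ k < 3, C (some (thetaPoint (lengths432 m) (firstPath m) k))
        (some (thetaPoint (lengths432 m) (firstPath m) (k + 1))) := by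
    intro j h0 hj hjc
    exact hC.path (pt := fun j => some (thetaPoint (lengths432 m) (firstPath m) j))
      (fun k h0 hk w hw => modifiedTheta_adj_inner h0 (by rw [get_first]; omega)
        (fun h => by omega) (hCG _ _ hw)) h0 hj hjc
  have exact_pair : ∀ {v a b}, C v a → C v b → a ≠ b → ∀ w, C v w → w = a ∨ w = b := by
    intro v a b ha hb hab w hw
    obtain ⟨a', b', -, e⟩ := hC.exists_pair (hC.mem _ _ (hC.symm _ _ ha))
    have h1 := (e a).1 ha
    have h2 := (e b).1 hb
    have h3 := (e w).1 hw
    grind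
  by_cases hq : ∃ j, 0 < j ∧ j < 3 ∧ some (thetaPoint (lengths432 m) (firstPath m) j) ∈ c
  · left
    obtain ⟨j, h0, hj, hjc⟩ := hq
    have hp := first j h0 hj hjc
    have hx := exact_pair (hC.symm _ _ hz1.1) (by simpa [thetaPoint_zero] using hp 0 (by omega))
      (by simp)
    have hr := exact_pair (hC.symm _ _ hz1.2) (hC.symm _ _ (hp 2 (by omega))) (by simp)
    have hout : ∀ i, i ≠ firstPath m → ∀ j, 0 < j → j < (lengths432 m).get i →
        some (thetaPoint (lengths432 m) i j) ∉ c := by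
      intro i hi j h0 hj hjc
      have := hx _ (other i hi j h0 hj hjc)
      simp only [reduceCtorEq, Option.some.injEq, false_or] at this
      exact hi (thetaPoint_eq_inner one_pos (by rw [get_first]; omega) this).1
    -- A cycle neighbor of y would be `r`, whose two cycle edges go to z and q, or an inner vertex
    -- of another path, excluded by `hout`.
    have hy : some (Sum.inl true) ∉ c := by
      intro hy
      obtain ⟨a, _, -, ha⟩ := hC.exists_pair (v := some (Sum.inl true)) hy
      have hya := (ha a).2 (Or.inl rfl)
      obtain ⟨i, rfl⟩ := modifiedTheta_adj_right (hCG _ _ hya)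
      by_cases hi : i = firstPath m
      · subst hi
        have := hr _ (hC.symm _ _ hya)
        simp only [reduceCtorEq, Option.some.injEq, false_or] at this
        exact (thetaPaths432 m).ne_right _ 2 (by omega) (by rw [get_first]; omega) this.symm
      · have := (thetaPaths432 m).two_le i
        exact hout i hi _ (by omega) (by omega) (hC.mem _ _ hya)
    have hlen := hc.length_eq (isCycleList_pentagon m) (fun v => ?_)
    · simpa using hlen
    simp only [List.mem_cons, List.mem_map, List.mem_range]
    constructor
    · intro hv
      rcases modifiedTheta_cases v with rfl | rfl | rfl | ⟨i, j, h0, hj, rfl⟩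
      · exact Or.inl rfl
      · exact Or.inr ⟨0, by omega, by rw [thetaPoint_zero]⟩
      · exact absurd hv hy
      · by_cases hi : i = firstPath m
        · subst hi
          exact Or.inr ⟨j, hj, rfl⟩
        · exact absurd hv (hout i hi j h0 hj)
    · rintro (rfl | ⟨j, hj, rfl⟩)
      · exact hz
      · rcases Nat.eq_zero_or_pos j with rfl | h0
        · exact hC.mem _ _ (hC.symm _ _ (hp 0 (by omega)))
        · have := hC.mem _ _ (hp (j - 1) (by omega))
          rwa [Nat.sub_add_cancel h0] at this
  · right
    push Not at hq
    refine (thetaPaths_short m).exists_pair hC ⟨none, hz⟩ (fun v hv => ?_) (fun w hw => ?_)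
      (fun w hw => ?_) (fun i j h0 hj w hw => ?_)
    · rcases modifiedTheta_cases v with rfl | rfl | rfl | ⟨i, j, h0, hj, rfl⟩
      · exact Or.inr (Or.inr ⟨firstPath m, mem_inner.2
          ⟨1, one_pos, by rw [shortLen_first]; omega, shortPoint_one⟩⟩)
      · exact Or.inl rfl
      · exact Or.inr (Or.inl rfl)
      · refine Or.inr (Or.inr ⟨i, ?_⟩)
        by_cases hi : i = firstPath m
        · subst hi
          rw [get_first] at hj
          obtain rfl : j = 3 := by
            by_contra h3
            exact hq j h0 (by omega) hv
          exact mem_inner.2 ⟨2, by omega, by rw [shortLen_first]; omega, shortPoint_two⟩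
        · exact mem_inner.2 ⟨j, h0, by rwa [shortLen_ne hi], shortPoint_ne hi j⟩
    · rcases modifiedTheta_adj_left (hCG _ _ hw) with rfl | ⟨i, rfl⟩
      · exact ⟨firstPath m, shortPoint_one.symm⟩
      · refine ⟨i, (shortPoint_ne ?_ 1).symm⟩
        rintro rfl
        exact hq 1 (by omega) (by omega) (hC.mem _ _ hw)
    · obtain ⟨i, rfl⟩ := modifiedTheta_adj_right (hCG _ _ hw)
      refine ⟨i, ?_⟩
      by_cases hi : i = firstPath m
      · subst hi
        rw [get_first, shortLen_first]
        exact shortPoint_two.symm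
      · rw [shortLen_ne hi, shortPoint_ne hi]
    · rcases shortPoint_inner h0 hj with ⟨rfl, rfl⟩ | ⟨rfl, rfl⟩ | ⟨hi, hj⟩
      · rw [shortPoint_one] at hw
        rw [shortPoint_zero, shortPoint_two]
        exact modifiedTheta_adj_none.1 (hCG _ _ hw)
      · rw [shortPoint_two] at hw
        rw [shortPoint_one, shortPoint_three]
        rcases modifiedTheta_adj (hCG _ _ hw) with ⟨e, -⟩ | ⟨b, rfl, hb⟩
        · exact Or.inl e
        · rcases thetaGraph_adj_inner (by omega) (by rw [get_first]; omega) hb with rfl | rfl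
          · exact absurd (hC.mem _ _ hw) (hq 2 (by omega) (by omega))
          · exact Or.inr (congrArg some thetaPoint_four)
      · rw [shortPoint_ne hi] at hw
        rw [shortPoint_ne hi, shortPoint_ne hi]
        exact modifiedTheta_adj_inner h0 hj (fun h => hi h.1) (hCG _ _ hw)

/-- The pentagon through z attains girth 5 for every `m`, including `m = 0`, where the original
theta graph has girth 6. The longest cycle is the union of the two original paths of length 4. -/
theorem modifiedTheta_isExample (m : ℕ) : IsExample (modifiedTheta m) (10 + 2 * m) 5 8 := by
  have h := thetaPaths_short m
  have hT : ThetaPaths (modifiedTheta m) (lengths432 m).get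
    (fun i j => some (thetaPoint (lengths432 m) i j)) (some (Sum.inl false))
      (some (Sum.inl true)) := (thetaPaths432 m).map_some
  have hab : firstPath m ≠ secondPath m := by simp [firstPath, secondPath]
  refine isExample_of_cycles ?_ (isVertexConnected_two_of_cycles h.ne
    (h.isCycleList hab).two_lt_card fun u => ?_) ⟨_, isCycleList_pentagon m, by simp⟩
    ⟨_, hT.isCycleList hab, hT.length_pairCycle _ _, fun c hc => ?_⟩
  · rw [Finite.card_option, card_thetaVertex]
    simp
    omega
  · cases u with
    | none =>
      refine ⟨_, h.isCycleList hab, mem_pairCycle.2 (by simp), mem_pairCycle.2 (by simp),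
        mem_pairCycle.2 (Or.inr (Or.inr (Or.inl (mem_inner.2 ⟨1, one_pos, ?_, shortPoint_one⟩))))⟩
      rw [shortLen_first]
      omega
    | some u =>
      obtain ⟨c, hc, hx, hy, hu⟩ := thetaGraph_exists_cycle (two_le_lengths432 m) hab u
      exact ⟨c.map some, hc.map some (Option.some_injective _)
        (fun a b => modifiedTheta_adj_some.2), List.mem_map_of_mem hx, List.mem_map_of_mem hy,
        List.mem_map_of_mem hu⟩
  · by_cases hz : none ∈ c
    -- Through z only one path of length 4 remains and the others have length at most 3, so such
    -- cycles never compete for the maximum.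
    · suffices 5 ≤ c.length ∧ c.length ≤ 7 from ⟨this.1, by omega, fun e => by omega⟩
      rcases modifiedTheta_cycle_of_none_mem hc hz with e | ⟨i, i', hi, hmem⟩
      · omega
      · rw [hc.length_eq (h.isCycleList hi) hmem, h.length_pairCycle]
        have h5 := five_le_lengths432 hi
        have b1 := (thetaPaths432 m).two_le i
        have b2 := (thetaPaths432 m).two_le i'
        have b3 := lengths432_cases i
        have b4 := lengths432_cases i'
        have b5 : shortLen m (secondPath m) = 4 := shortLen_ne hab.symm
        rcases b3 with rfl | rfl | b3 <;> rcases b4 with rfl | rfl | b4 <;>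
          first
          | exact absurd rfl hi
          | rw [shortLen_first, b5]; omega
          | skip
        · rw [shortLen_first, shortLen_ne hi.symm]; omega
        · rw [b5, shortLen_ne (by rintro rfl; rw [get_first] at b4; omega)]
          rw [get_second] at h5
          omega
        · rw [shortLen_first, shortLen_ne hi]; omega
        · rw [b5, shortLen_ne (by rintro rfl; rw [get_first] at b3; omega)]
          rw [get_second] at h5
          omega
        · rw [shortLen_ne (by rintro rfl; rw [get_first] at b3; omega),
            shortLen_ne (by rintro rfl; rw [get_first] at b4; omega)]
          omega
    · obtain ⟨i, i', hi, hmem⟩ := modifiedTheta_cycle_of_none_notMem hc hz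
      rw [hc.length_eq (hT.isCycleList hi) hmem, hT.length_pairCycle]
      have h5 := five_le_lengths432 hi
      have e1 := get_first (m := m)
      have e2 := get_second (m := m)
      refine ⟨h5, ?_, fun h8 v hv => ?_⟩
      · rcases lengths432_cases i with rfl | rfl | b3 <;>
          rcases lengths432_cases i' with rfl | rfl | b4 <;> omega
      · have hv' := (hmem v).1 hv
        rcases lengths432_cases i with rfl | rfl | b3 <;>
          rcases lengths432_cases i' with rfl | rfl | b4 <;>
          first | exact absurd rfl hi | exact hv' | omega | skip
        rw [mem_pairCycle] at hv' ⊢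
        tauto

end

/-! ### Transport along isomorphisms -/

section Iso

variable {V W : Type*} {G : SimpleGraph V} {H : SimpleGraph W}

theorem IsCycleList.iso {l : List V} (h : IsCycleList G l) (e : G ≃g H) :
    IsCycleList H (l.map e) :=
  h.map e e.injective fun _ _ hab => e.map_adj_iff.2 hab

theorem IsLongest.iso {l : List V} (h : IsLongest G l) (e : G ≃g H) :
    IsLongest H (l.map e) :=
  ⟨h.1.iso e, fun l' hl' => by simpa using h.2 _ (hl'.iso e.symm)⟩

theorem cc_le_of_iso [Finite W] (e : G ≃g H) : cc G ≤ cc H := by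
  rw [cc_eq_ncard_covered, cc_eq_ncard_covered]
  refine Set.ncard_le_ncard_of_injOn e ?_ e.injective.injOn (Set.toFinite _)
  rintro v ⟨l, hl, hv⟩
  exact ⟨l.map e, hl.iso e, List.mem_map_of_mem hv⟩

theorem cc_eq_of_iso [Finite V] [Finite W] (e : G ≃g H) : cc G = cc H :=
  le_antisymm (cc_le_of_iso e) (cc_le_of_iso e.symm)

theorem IsVertexConnected.iso {k : ℕ} (h : IsVertexConnected G k) (e : G ≃g H) :
    IsVertexConnected H k := by
  refine ⟨(Nat.card_congr e.toEquiv) ▸ h.1, fun S hS => ?_⟩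
  let S' : Finset V := S.map e.symm.toEquiv.toEmbedding
  have hmem : ∀ v, v ∈ S' ↔ e v ∈ S := by
    intro v
    simp only [S', Finset.mem_map]
    constructor
    · rintro ⟨w, hw, rfl⟩
      simpa using hw
    · intro hv
      exact ⟨e v, hv, by simp⟩
  have hconn := h.2 S' (by simpa [S'] using hS)
  let f : G.induce ((S' : Set V)ᶜ) →g H.induce ((S : Set W)ᶜ) :=
    ⟨fun v => ⟨e v, fun hv => v.2 ((hmem v).2 hv)⟩, fun {a b} hab => e.map_adj_iff.2 hab⟩
  refine hconn.map f ?_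
  rintro ⟨w, hw⟩
  refine ⟨⟨e.symm w, fun hv => hw ?_⟩, Subtype.ext (e.apply_symm_apply w)⟩
  simpa using (hmem _).1 hv

end Iso

theorem IsExample.mem_ccValues {V : Type*} [Finite V] {G : SimpleGraph V} {n g c : ℕ}
    (h : IsExample G n g c) : c ∈ ccValues n g := by
  obtain ⟨f⟩ : Nonempty (V ≃ Fin n) := by
    have := Finite.equivFin V
    rw [h.order] at this
    exact ⟨this⟩
  let e : G ≃g G.map f.toEmbedding := SimpleGraph.Iso.map f G
  exact ⟨G.map f.toEmbedding, h.connected.iso e, by rw [← e.egirth_eq, h.girth],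
    by rw [← cc_eq_of_iso e, h.covering]⟩

theorem isLeast_ccValues {n g c : ℕ} (h : c ∈ ccValues n g)
    (hle : ∀ G : SimpleGraph (Fin n), IsVertexConnected G 2 → (g : ℕ∞) ≤ G.egirth → c ≤ cc G) :
    IsLeast (ccValues n g) c :=
  ⟨h, fun _ ⟨G, h1, h2, h3⟩ => h3 ▸ hle G h1 h2⟩

/-! ### The extremal families and the conclusion -/

/-- The bound on `n` is what provides two paths of the shortest length, at indices 2 and 3, whose
union attains the girth. The next two families work in the same way. -/
theorem isExample_theta_three_two {n : ℕ} (hn : 8 ≤ n) :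
    IsExample (thetaGraph ([3, 3] ++ List.replicate (n - 6) 2)) n 4 6 := by
  refine thetaGraph_isExample (p := 3) (q := 3) ?_ ?_ ?_ ?_
    ⟨⟨2, by simp; omega⟩, ⟨3, by simp; omega⟩, by simp, by simp⟩
  · simp [List.mem_replicate]
  · simp [List.mem_replicate]
  · simp
    omega
  · simp [List.pairwise_replicate, List.mem_replicate]

theorem isExample_theta_four_three {n : ℕ} (hn : 12 ≤ n) (he : Even n) :
    IsExample (thetaGraph ([4, 4] ++ List.replicate ((n - 8) / 2) 3)) n 6 8 := by
  obtain ⟨k, rfl⟩ := he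
  refine thetaGraph_isExample (p := 4) (q := 4) ?_ ?_ ?_ ?_
    ⟨⟨2, by simp; omega⟩, ⟨3, by simp; omega⟩, by simp, by simp⟩
  · simp [List.mem_replicate]
  · simp [List.mem_replicate]
  · simp
    omega
  · simp [List.pairwise_replicate, List.mem_replicate]

theorem isExample_theta_five_four_three {n : ℕ} (hn : 13 ≤ n) (ho : Odd n) :
    IsExample (thetaGraph ([5, 4] ++ List.replicate ((n - 9) / 2) 3)) n 6 9 := by
  obtain ⟨k, rfl⟩ := ho
  refine thetaGraph_isExample (p := 5) (q := 4) ?_ ?_ ?_ ?_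
    ⟨⟨2, by simp; omega⟩, ⟨3, by simp; omega⟩, by simp, by simp⟩
  · simp [List.mem_replicate]
  · simp [List.mem_replicate]
  · simp
    omega
  · simp [List.pairwise_replicate, List.mem_replicate]

theorem isExample_lengths432 {n : ℕ} (hn : 10 ≤ n) (ho : Odd n) :
    IsExample (thetaGraph (lengths432 ((n - 9) / 2))) n 5 8 := by
  obtain ⟨k, rfl⟩ := ho
  -- An odd order is at least 11, so there is a path of length 3, at index 2. With the path of
  -- length 2, at the last index `m + 3`, it forms the 5-cycle.
  obtain ⟨m, hm⟩ : ∃ m, (2 * k + 1 - 9) / 2 = m + 1 := ⟨k - 5, by omega⟩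
  rw [hm]
  refine thetaGraph_isExample (p := 4) (q := 4) (two_le_lengths432 _) ?_ ?_
    (pairwise_lengths432 _) ⟨⟨2, by simp⟩, ⟨m + 3, by simp⟩, by simp, ?_⟩
  · simp [List.mem_replicate]
  · simp
    omega
  · simp [List.replicate_succ]

theorem isExample_modifiedTheta {n : ℕ} (hn : 10 ≤ n) (he : Even n) :
    IsExample (modifiedTheta ((n - 10) / 2)) n 5 8 := by
  have := modifiedTheta_isExample ((n - 10) / 2)
  rwa [show 10 + 2 * ((n - 10) / 2) = n by obtain ⟨k, rfl⟩ := he; omega] at this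

end Cummerbund

theorem theorem16 :
    -- girth at least 4, order at least 8
    (∀ n : ℕ, 8 ≤ n →
      IsLeast (Cummerbund.ccValues n 4) 6 ∧
      Cummerbund.IsExample
        (Cummerbund.thetaGraph ([3, 3] ++ List.replicate (n - 6) 2)) n 4 6) ∧
    -- girth at least 5, order at least 10
    (∀ n : ℕ, 10 ≤ n →
      IsLeast (Cummerbund.ccValues n 5) 8 ∧
      (Odd n → Cummerbund.IsExample
        (Cummerbund.thetaGraph (Cummerbund.lengths432 ((n - 9) / 2))) n 5 8) ∧
      (Even n → Cummerbund.IsExample (Cummerbund.modifiedTheta ((n - 10) / 2)) n 5 8)) ∧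
    -- girth at least 6, even order at least 12
    (∀ n : ℕ, 12 ≤ n → Even n →
      IsLeast (Cummerbund.ccValues n 6) 8 ∧
      Cummerbund.IsExample
        (Cummerbund.thetaGraph ([4, 4] ++ List.replicate ((n - 8) / 2) 3)) n 6 8) ∧
    -- girth at least 6, odd order at least 13
    (∀ n : ℕ, 13 ≤ n → Odd n →
      IsLeast (Cummerbund.ccValues n 6) 9 ∧
      Cummerbund.IsExample
        (Cummerbund.thetaGraph ([5, 4] ++ List.replicate ((n - 9) / 2) 3)) n 6 9) := by
  refine ⟨fun n hn => ?_, fun n hn => ?_, fun n hn he => ?_, fun n hn ho => ?_⟩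
  · have h := Cummerbund.isExample_theta_three_two hn
    exact ⟨Cummerbund.isLeast_ccValues h.mem_ccValues fun G h1 h2 =>
      Cummerbund.six_le_cc h1 h2 (by simp; omega), h⟩
  · refine ⟨Cummerbund.isLeast_ccValues ?_ fun G h1 h2 =>
      Cummerbund.eight_le_cc h1 h2 (by simpa using hn),
      Cummerbund.isExample_lengths432 hn, Cummerbund.isExample_modifiedTheta hn⟩
    rcases Nat.even_or_odd n with he | ho
    · exact (Cummerbund.isExample_modifiedTheta hn he).mem_ccValues
    · exact (Cummerbund.isExample_lengths432 hn ho).mem_ccValues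
  -- For even order the bound for girth at least 5 is already sharp at girth 6.
  · have h := Cummerbund.isExample_theta_four_three hn he
    exact ⟨Cummerbund.isLeast_ccValues h.mem_ccValues fun G h1 h2 =>
      Cummerbund.eight_le_cc h1 (le_trans (by norm_num) h2) (by simp; omega), h⟩
  · have h := Cummerbund.isExample_theta_five_four_three hn ho
    exact ⟨Cummerbund.isLeast_ccValues h.mem_ccValues fun G h1 h2 =>
      Cummerbund.nine_le_cc h1 h2 (by simp; omega) (by simpa using ho), h⟩
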